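/- Let $k$ be an algebraically closed field. A $k$-linear category is *finite abelian* if it is $k$-linearly equivalent to the category of finite-dimensional modules over some finite-dimensional $k$-algebra. A *finite tensor category* over $k$ is a rigid monoidal category $\mathcal{C}$ that is finite abelian over $k$, whose tensor product is $k$-linear in each variable, and such that $\mathrm{End}_{\mathcal{C}}(\mathbf{1}) \cong k$ as algebras. For an object $X$ of $\mathcal{C}$ let $X^*$ denote its left dual, with evaluation $X^* \otimes X \to \mathbf{1}$ and coevaluation $\mathbf{1} \to X \otimes X^*$, and let ${}^*X$ denote its right dual, with evaluation $X \otimes {}^*X \to \mathbf{1}$ and coevaluation $\mathbf{1} \to {}^*X \otimes X$. Let $\mathcal{C} \boxtimes \mathcal{C}$ be a Deligne tensor product of $\mathcal{C}$ with itself, that is, a $k$-linear abelian category with a functor $\boxtimes : \mathcal{C} \times \mathcal{C} \to \mathcal{C} \boxtimes \mathcal{C}$ that is $k$-bilinear and right exact in each variable and is universal among such functors to $k$-linear abelian categories: for every $k$-linear abelian category $\mathcal{E}$, composition with $\boxtimes$ is an equivalence from the category of $k$-linear right exact functors $\mathcal{C} \boxtimes \mathcal{C} \to \mathcal{E}$ to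 the category of functors $\mathcal{C} \times \mathcal{C} \to \mathcal{E}$ that are $k$-bilinear and right exact in each variable. For an abelian category $\mathcal{A}$, let $\mathrm{Gr}(\mathcal{A})$ be its Grothendieck group, generated by classes $[X]$ of objects with relations $[Y] = [X] + [Z]$ for all short exact sequences $0 \to X \to Y \to Z \to 0$. For objects $X$ and $V$ of $\mathcal{C}$ with $V$ simple, let $[X : V]$ be the multiplicity of $V$ in a composition series of $X$. **Theorem.** Let $\mathcal{C}$ be a finite tensor category over $k$, let $\{V_i\}_{i \in I}$ (with $I$ finite) be a complete set of representatives of the isomorphism classes of simple objects of $\mathcal{C}$, and for each $i$ let $P_i$ be a projective cover of $V_i$. For every $k$-linear left exact functor $F : \mathcal{C} \to \mathcal{C}$, the coend $\int^{X \in \mathcal{C}} {}^*X \boxtimes F(X)$ exists in $\mathcal{C} \boxtimes \mathcal{C}$, and $$\left[ \int^{X \in \mathcal{C}} {}^*X \boxtimes F(X) \right] = \sum_{i, j \in I} [F(P_i^*) : V_j] \cdot [V_i \boxtimes V_j]$$ in $\mathrm{Gr}(\mathcal{C} \boxtimes \mathcal{C})$. -/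

import Mathlib

open CategoryTheory CategoryTheory.Limits MonoidalCategory

universe w v u u₁ u₂ u₃

namespace FTC

/-! ### Finite abelian categories and finite tensor categories -/

section Finite

variable (k : Type w) [Field k] (C : Type u) [Category.{v} C] [Preadditive C] [Linear k C]

/-- A `k`-linear category is finite abelian if it is `k`-linearly equivalent to the category
of finitely generated (equivalently, finite-dimensional) left modules over some
finite-dimensional `k`-algebra. -/
class IsFiniteAbelian : Prop where
  exists_equivalence : ∃ (A : Type v) (_ : Ring A) (_ : Algebra k A) (_ : Module.Finite k A)
    (e : C ≌ FGModuleCat.{v} A), e.functor.Additive ∧ e.functor.Linear k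

/-- Finite tensor categories: rigid monoidal categories which are finite abelian over `k`, with
`k`-bilinear tensor product, and with `End(𝟙) ≅ k` as algebras. -/
class IsFiniteTensorCategory [MonoidalCategory C] [RigidCategory C] : Prop extends
    IsFiniteAbelian k C, MonoidalPreadditive C, MonoidalLinear k C where
  end_unit : Nonempty (End (𝟙_ C) ≃ₐ[k] k)

end Finite

/-! ### The Deligne tensor product -/

section Deligne

variable (k : Type w) [Field k]

/-- `k`-linear right exact functors. -/
structure IsRex {C : Type u₁} [Category.{v} C] [Preadditive C] [Linear k C]
    {E : Type u₂} [Category.{v} E] [Preadditive E] [Linear k E] (G : C ⥤ E) : Prop where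
  additive : G.Additive
  linear : G.Linear k
  rightExact : PreservesFiniteColimits G

/-- Bifunctors which are `k`-bilinear and right exact in each variable. -/
structure IsBirex {C₁ : Type u₁} [Category.{v} C₁] [Preadditive C₁] [Linear k C₁]
    {C₂ : Type u₂} [Category.{v} C₂] [Preadditive C₂] [Linear k C₂]
    {E : Type u₃} [Category.{v} E] [Preadditive E] [Linear k E] (B : C₁ ⥤ C₂ ⥤ E) : Prop where
  right : ∀ X : C₁, IsRex k (B.obj X)
  left : ∀ Y : C₂, IsRex k (B.flip.obj Y)

/-- The category of `k`-linear right exact functors `C ⥤ E`. -/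
abbrev Rex (C : Type u₁) [Category.{v} C] [Preadditive C] [Linear k C]
    (E : Type u₂) [Category.{v} E] [Preadditive E] [Linear k E] :=
  ObjectProperty.FullSubcategory (fun G : C ⥤ E => IsRex k G)

/-- The category of bifunctors `C₁ × C₂ → E` which are `k`-bilinear and right exact in each
variable. -/
abbrev Birex (C₁ : Type u₁) [Category.{v} C₁] [Preadditive C₁] [Linear k C₁]
    (C₂ : Type u₂) [Category.{v} C₂] [Preadditive C₂] [Linear k C₂]
    (E : Type u₃) [Category.{v} E] [Preadditive E] [Linear k E] :=
  ObjectProperty.FullSubcategory (fun B : C₁ ⥤ C₂ ⥤ E => IsBirex k B)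

variable {C₁ : Type u₁} [Category.{v} C₁] [Preadditive C₁] [Linear k C₁]
  {C₂ : Type u₂} [Category.{v} C₂] [Preadditive C₂] [Linear k C₂]
  {D : Type u₃} [Category.{v} D] [Preadditive D] [Linear k D]

/-- The functor `G ↦ G ∘ box` from functors `D ⥤ E` to bifunctors `C₁ × C₂ → E`. -/
def precomp (box : C₁ ⥤ C₂ ⥤ D) (E : Type u) [Category.{v} E] : (D ⥤ E) ⥤ (C₁ ⥤ C₂ ⥤ E) :=
  Functor.whiskeringRight C₂ D E ⋙
    (Functor.whiskeringLeft C₁ (C₂ ⥤ D) (C₂ ⥤ E)).obj box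

variable {k}

theorem IsRex.comp {C : Type u₁} [Category.{v} C] [Preadditive C] [Linear k C]
    {E : Type u} [Category.{v} E] [Preadditive E] [Linear k E]
    {H : C ⥤ D} {G : D ⥤ E} (hH : IsRex k H) (hG : IsRex k G) : IsRex k (H ⋙ G) := by
  obtain ⟨_, _, _⟩ := hH
  obtain ⟨_, _, _⟩ := hG
  exact ⟨inferInstance, inferInstance, comp_preservesFiniteColimits _ _⟩

theorem IsBirex.precomp {box : C₁ ⥤ C₂ ⥤ D} (hbox : IsBirex k box)
    {E : Type u} [Category.{v} E] [Preadditive E] [Linear k E] {G : D ⥤ E} (hG : IsRex k G) :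
    IsBirex k ((precomp box E).obj G) :=
  ⟨fun X => (hbox.right X).comp hG, fun Y => (hbox.left Y).comp hG⟩

/-- The functor `G ↦ G ∘ box` from `k`-linear right exact functors `D ⥤ E` to bifunctors
`C₁ × C₂ → E` that are `k`-bilinear and right exact in each variable. -/
def rexPrecomp {box : C₁ ⥤ C₂ ⥤ D} (hbox : IsBirex k box)
    (E : Type u) [Category.{v} E] [Preadditive E] [Linear k E] :
    Rex k D E ⥤ Birex k C₁ C₂ E :=
  ObjectProperty.lift _ (ObjectProperty.ι _ ⋙ precomp box E)
    (fun G => hbox.precomp G.property)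

variable (k)

/-- `(D, box)` is a Deligne tensor product of the `k`-linear abelian categories `C₁`, `C₂`
(where `D` is itself a `k`-linear abelian category): `box` is `k`-bilinear and right exact in each
variable, and is universal with this property, i.e. for every `k`-linear abelian category `E`,
composition with `box` is an equivalence from the category of `k`-linear right exact functors
`D ⥤ E` to the category of bifunctors `C₁ × C₂ → E` which are `k`-bilinear and right exact in
each variable. -/
structure IsDeligneProduct (box : C₁ ⥤ C₂ ⥤ D) : Prop where
  birex : IsBirex k box
  universal : ∀ (E : Type (max u₃ (v + 1))) [Category.{v} E] [Abelian E] [Linear k E],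
    (rexPrecomp birex E).IsEquivalence

end Deligne

/-! ### Grothendieck groups -/

section Gr

variable (D : Type u) [Category.{v} D] [Abelian D]

/-- The subgroup generated by the relations `[X₂] = [X₁] + [X₃]` for all short exact sequences
`0 ⟶ X₁ ⟶ X₂ ⟶ X₃ ⟶ 0`. -/
def grRelations : AddSubgroup (FreeAbelianGroup D) :=
  AddSubgroup.closure {x | ∃ S : ShortComplex D, S.ShortExact ∧
    x = FreeAbelianGroup.of S.X₂ - FreeAbelianGroup.of S.X₁ - FreeAbelianGroup.of S.X₃}

/-- The Grothendieck group of an abelian category. -/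
abbrev Gr : Type u := FreeAbelianGroup D ⧸ grRelations D

variable {D}

/-- The class `[X]` of an object in the Grothendieck group. -/
def grClass (X : D) : Gr D := QuotientAddGroup.mk (FreeAbelianGroup.of X)

end Gr

/-! ### Composition series and multiplicities -/

section JordanHolder

variable {C : Type u} [Category.{v} C] [Abelian C]

/-- A composition series `0 = X₀ ⊆ X₁ ⊆ ⋯ ⊆ Xₙ = X` with simple factors. -/
structure CompSeries (X : C) where
  length : ℕ
  obj : Fin (length + 1) → Subobject X
  le_succ : ∀ i : Fin length, obj i.castSucc ≤ obj i.succ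
  bot : obj 0 = ⊥
  top : obj (Fin.last length) = ⊤
  simple : ∀ i : Fin length, Simple (cokernel (Subobject.ofLE _ _ (le_succ i)))

/-- The `i`-th composition factor `Xᵢ₊₁ / Xᵢ`. -/
noncomputable def CompSeries.factor {X : C} (s : CompSeries X) (i : Fin s.length) : C :=
  cokernel (Subobject.ofLE _ _ (s.le_succ i))

/-- The number of composition factors isomorphic to `V` in a given composition series. -/
noncomputable def CompSeries.count {X : C} (s : CompSeries X) (V : C) : ℕ :=
  Nat.card {i : Fin s.length // Nonempty (s.factor i ≅ V)}

open Classical in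
/-- The multiplicity `[X : V]` of the simple object `V` in a composition series of `X`. By the
Jordan–Hölder theorem it does not depend on the composition series. (The value is `0` if `X` has
no composition series.) -/
noncomputable def multiplicity (X V : C) : ℕ :=
  if h : Nonempty (CompSeries X) then h.some.count V else 0

end JordanHolder

/-! ### Projective covers -/

/-- `π : P ⟶ V` is a projective cover: `P` is projective and `π` is an essential epimorphism,
i.e. an epimorphism such that `g` is epi as soon as `g ≫ π` is. -/
structure IsProjectiveCover {C : Type u} [Category.{v} C] {P V : C} (π : P ⟶ V) : Prop where
  projective : Projective P
  epi : Epi π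
  essential : ∀ {Z : C} (g : Z ⟶ P), Epi (g ≫ π) → Epi g

/-! ### The coend of `(X, Y) ↦ *X ⊠ F(Y)` -/

section Coend

variable {C : Type u₁} [Category.{v} C] [MonoidalCategory C] [LeftRigidCategory C]

variable (C) in
/-- The contravariant functor `X ↦ ᘁX`, where `ᘁX` comes with morphisms `X ⊗ ᘁX ⟶ 𝟙` and
`𝟙 ⟶ ᘁX ⊗ X`. Mathlib calls `ᘁX` the left dual of `X`; in the convention in which the left dual
`X^*` has an evaluation `X^* ⊗ X ⟶ 𝟙`, it is the right dual `*X`. -/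
def starLeft : Cᵒᵖ ⥤ C where
  obj X := ᘁX.unop
  map f := ᘁf.unop
  map_id _ := leftAdjointMate_id
  map_comp _ _ := comp_leftAdjointMate

/-- The functor `(X, Y) ↦ *X ⊠ F(Y)` whose coend is `∫^X *X ⊠ F(X)`. -/
def coendIntegrand {D : Type u₂} [Category.{v} D] (box : C ⥤ C ⥤ D) (F : C ⥤ C) :
    Cᵒᵖ ⥤ C ⥤ D :=
  starLeft C ⋙ box ⋙ (Functor.whiskeringLeft C C D).obj F

end Coend

end FTC

/-! Consider functors `M` from the opposite of the full subcategory on the projective covers `P a`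
to `C`. They model the Deligne product: `X ⊠ Y` corresponds to `a ↦ Hom(P a, X) ⊗ Y` (`coverBox`).
In the other direction, `M` yields Ψ(M) = ∫^a `P a ⊠ M a`, a cokernel between finite direct sums in
`D` (`coverCoend`).

Existence of the coend: maps `Q ⟶ *X` are the same as maps `X ⟶ Q^*`. Every `*X` is presented by the
`P a`, and `⊠` is right exact, so the coend over all `X` collapses to the finite one, Ψ(`a ↦ F((P
a)^*)`) (`exists_isColimit_cowedge`).

Its class: a linear `M` is filtered by the functors `coverBox(V a, V b)`, each occurring dim Hom(`P
b`, `M a`) = [`M a` : `V b`] times. Ψ sends `coverBox(X, Y)` to `X ⊠ Y` by co-Yoneda, so the formula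
follows by additivity (`grClass_coverCoendObj`) once Ψ is known to be exact.

Right exactness of Ψ is formal. Preservation of monomorphisms is the crux, because `D` is known only
through its universal property. As `coverBox` is right exact in each variable, it extends to a right
exact `G : D ⥤ CoverMod P`. Then `G ⋙` Ψ agrees with the identity on `box`, hence is isomorphic to
it, and `G` is faithful. For linear `M`, a natural monomorphism from each value of `G`(Ψ(M)) to that
of `M` shows that `G`(Ψ(f)) is mono when f is, and faithfulness carries this back to Ψ(f)
(`mono_coverCoendMap`). -/

namespace FTC

/-! ### Finite abelian categories: finite-dimensional Homs and simple quotients -/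

section FiniteAbelian

variable {k : Type w} [Field k]

theorem finite_hom_fgModuleCat {A : Type v} [Ring A] [Algebra k A] [Module.Finite k A]
    (M N : FGModuleCat.{v} A) : Module.Finite k (M ⟶ N) := by
  let : Module k N := Module.compHom N (algebraMap k A)
  have : IsScalarTower k A N := ⟨fun a b x => by
    rw [Algebra.smul_def, mul_smul]; rfl⟩
  have : Module.Finite k N := Module.Finite.trans A N
  obtain ⟨n, s, hs⟩ := Module.Finite.exists_fin (R := A) (M := M)
  let ev : (M ⟶ N) →ₗ[k] (Fin n → N) :=
    { toFun := fun f i => f.hom.hom (s i)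
      map_add' := fun f g => rfl
      map_smul' := fun c f => rfl }
  refine Module.Finite.of_injective ev fun f g hfg => ?_
  ext1
  exact LinearMap.ext_on_range hs fun i => congrFun hfg i

theorem exists_simple_quotient_fgModuleCat {A : Type v} [Ring A] [IsNoetherianRing A]
    (M : FGModuleCat.{v} A) (hM : ¬ IsZero M) :
    ∃ (S : FGModuleCat.{v} A) (q : M ⟶ S), Simple S ∧ Epi q := by
  have hnt : Nontrivial M := by
    by_contra h
    rw [not_nontrivial_iff_subsingleton] at h
    apply hM
    rw [IsZero.iff_id_eq_zero]
    ext x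
    exact Subsingleton.elim (α := M) _ _
  obtain ⟨N, hN, -⟩ := (eq_top_or_exists_le_coatom (⊥ : Submodule A M)).resolve_left
    bot_ne_top
  have : IsSimpleModule A (M ⧸ N) := isSimpleModule_iff_isCoatom.2 hN
  let S : FGModuleCat.{v} A := FGModuleCat.of A (M ⧸ N)
  refine ⟨S, FGModuleCat.ofHom N.mkQ, ?_, ?_⟩
  · have : Simple ((forget₂ (FGModuleCat.{v} A) (ModuleCat.{v} A)).obj S) :=
      inferInstanceAs (Simple (ModuleCat.of A (M ⧸ N)))
    have : (forget₂ (FGModuleCat.{v} A) (ModuleCat.{v} A)).PreservesZeroMorphisms :=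
      ⟨fun _ _ => rfl⟩
    exact Functor.simple_of_simple_obj (forget₂ (FGModuleCat.{v} A) (ModuleCat.{v} A)) S
  · constructor
    intro Z g h hgh
    ext x
    exact congrArg (fun φ : M ⟶ Z => φ.hom.hom x) hgh

variable {C : Type u₁} [Category.{v} C] [Preadditive C] [Linear k C]

theorem IsFiniteAbelian.finite_hom [IsFiniteAbelian k C] (X Y : C) :
    Module.Finite k (X ⟶ Y) := by
  obtain ⟨A, _, _, _, e, _, _⟩ := IsFiniteAbelian.exists_equivalence (k := k) (C := C)
  have := finite_hom_fgModuleCat (k := k) (e.functor.obj X) (e.functor.obj Y)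
  exact Module.Finite.of_injective (e.functor.mapLinearMap k (X := X) (Y := Y))
    e.functor.map_injective

variable (k) in
theorem IsFiniteAbelian.exists_simple_quotient [IsFiniteAbelian k C] (X : C) (hX : ¬ IsZero X) :
    ∃ (S : C) (q : X ⟶ S), Simple S ∧ Epi q := by
  obtain ⟨A, _, _, _, e, _, _⟩ := IsFiniteAbelian.exists_equivalence (k := k) (C := C)
  have : IsNoetherianRing A := IsNoetherianRing.of_finite k A
  obtain ⟨S, q, hS, hq⟩ := exists_simple_quotient_fgModuleCat (e.functor.obj X)
    (fun h => hX (IsZero.of_iso (e.inverse.map_isZero h) (e.unitIso.app X)))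
  refine ⟨e.inverse.obj S, e.unitIso.hom.app X ≫ e.inverse.map q, simple_obj e.inverse S, ?_⟩
  infer_instance

variable (k C) in
/-- A finite abelian category has a set of objects of the size of its sets of morphisms, raised
by one universe, which meets every isomorphism class. -/
theorem IsFiniteAbelian.exists_small_model [IsFiniteAbelian k C] :
    ∃ (T : Type (v + 1)) (_ : Category.{v} T), Nonempty (T ≌ C) := by
  obtain ⟨A, _, _, _, e, _, _⟩ := IsFiniteAbelian.exists_equivalence (k := k) (C := C)
  exact ⟨_, _, ⟨e.symm⟩⟩

end FiniteAbelian

/-! ### Projective covers of the simple objects -/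

section ProjectiveCovers

attribute [local instance] Abelian.hasFiniteBiproducts

variable (k : Type w) [Field k] {C : Type u₁} [Category.{v} C] [Abelian C] [Linear k C]

/-- A finite complete irredundant family of simple objects with projective covers, in a category
in which all nonzero objects have simple quotients. -/
structure IsCoverSystem {n : ℕ} {V P : Fin n → C} (π : ∀ i, P i ⟶ V i) : Prop where
  simple : ∀ i, Simple (V i)
  complete : ∀ S : C, Simple S → ∃ i, Nonempty (S ≅ V i)
  eq_of_iso : ∀ {i j}, (V i ≅ V j) → i = j
  cover : ∀ i, IsProjectiveCover (π i)
  exists_simple_quotient : ∀ X : C, ¬ IsZero X → ∃ (S : C) (q : X ⟶ S), Simple S ∧ Epi q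

/-- If `f ≠ 0`, its kernel cannot map onto `V`: by essentiality it would be all of `P`. So `π`
factors through `f`, and the induced map `S ⟶ V` is nonzero between simples, hence invertible. -/
theorem IsProjectiveCover.exists_fac {P V S : C} {π : P ⟶ V} (hπ : IsProjectiveCover π)
    [Simple V] [Simple S] (f : P ⟶ S) : ∃ g : V ⟶ S, π ≫ g = f := by
  by_cases hf : f = 0
  · exact ⟨0, by simp [hf]⟩
  have := hπ.epi
  have hfe : Epi f := epi_of_nonzero_to_simple hf
  have h0 : kernel.ι f ≫ π = 0 := by
    by_contra h
    have : Epi (kernel.ι f ≫ π) := epi_of_nonzero_to_simple h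
    have : Epi (kernel.ι f) := hπ.essential _ this
    exact hf (by rw [← cancel_epi (kernel.ι f)]; simp)
  have hg : f ≫ Abelian.epiDesc f π h0 = π := Abelian.comp_epiDesc f π h0
  have hne : Abelian.epiDesc f π h0 ≠ 0 := by
    intro h
    rw [h, comp_zero] at hg
    apply Simple.not_isZero V
    rw [IsZero.iff_id_eq_zero, ← cancel_epi π, ← hg]
    simp
  have := isIso_of_hom_simple hne
  exact ⟨inv (Abelian.epiDesc f π h0), (IsIso.comp_inv_eq _).2 hg.symm⟩

theorem finrank_hom_of_shortExact [∀ X Y : C, Module.Finite k (X ⟶ Y)] (P : C) [Projective P]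
    {S : ShortComplex C} (hS : S.ShortExact) :
    Module.finrank k (P ⟶ S.X₂) = Module.finrank k (P ⟶ S.X₁) + Module.finrank k (P ⟶ S.X₃) := by
  have := hS.mono_f
  have := hS.epi_g
  let φ : (P ⟶ S.X₁) →ₗ[k] (P ⟶ S.X₂) := Linear.rightComp k P S.f
  let ψ : (P ⟶ S.X₂) →ₗ[k] (P ⟶ S.X₃) := Linear.rightComp k P S.g
  have hφ : Function.Injective φ := fun a b h => (cancel_mono S.f).1 h
  have hψ : Function.Surjective ψ := fun a =>
    ⟨Projective.factorThru a S.g, Projective.factorThru_comp a S.g⟩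
  have hex : LinearMap.ker ψ = LinearMap.range φ := by
    ext a
    rw [LinearMap.mem_ker, LinearMap.mem_range]
    constructor
    · intro h
      exact ⟨hS.exact.lift a h, hS.exact.lift_f a h⟩
    · rintro ⟨b, rfl⟩
      simp [φ, ψ]
  have h1 := LinearMap.finrank_range_add_finrank_ker ψ
  rw [hex, LinearMap.finrank_range_of_inj hφ, LinearMap.range_eq_top.2 hψ, finrank_top] at h1
  omega

namespace IsCoverSystem

variable {n : ℕ} {V P : Fin n → C} {π : ∀ i, P i ⟶ V i}

variable {k} in
theorem projective (h : IsCoverSystem π) (i : Fin n) : Projective (P i) := (h.cover i).projective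

variable [∀ X Y : C, Module.Finite k (X ⟶ Y)]

/-- All maps from `P i` to a simple object factor through `V i`, so this is Schur's lemma over an
algebraically closed field. -/
theorem finrank_hom_simple [IsAlgClosed k] (h : IsCoverSystem π) (i : Fin n) (S : C) [Simple S]
    [Decidable (Nonempty (S ≅ V i))] :
    Module.finrank k (P i ⟶ S) = if Nonempty (S ≅ V i) then 1 else 0 := by
  have := h.simple i
  have := (h.cover i).epi
  have e : Module.finrank k (V i ⟶ S) = Module.finrank k (P i ⟶ S) :=
    (LinearEquiv.ofBijective (Linear.leftComp k S (π i))
      ⟨fun a b hab => (cancel_epi (π i)).1 hab, fun f => (h.cover i).exists_fac f⟩).finrank_eq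
  rw [← e]
  split_ifs with hS
  · exact (finrank_hom_simple_simple_eq_one_iff k (V i) S).2 (hS.map Iso.symm)
  · exact finrank_hom_simple_simple_eq_zero_of_not_iso k fun e => hS ⟨e.symm⟩

theorem finrank_hom_cover [IsAlgClosed k] (h : IsCoverSystem π) (i j : Fin n) :
    Module.finrank k (P i ⟶ V j) = if j = i then 1 else 0 := by
  classical
  have := h.simple j
  rw [h.finrank_hom_simple k i (V j)]
  congr 1
  exact propext ⟨fun ⟨e⟩ => h.eq_of_iso e, fun e => ⟨eqToIso (by rw [e])⟩⟩

-- Projectivity lifts the cover of a simple quotient of `X` to a map into `X`.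
omit [∀ X Y : C, Module.Finite k (X ⟶ Y)] [Linear k C] in
theorem exists_hom_ne_zero (h : IsCoverSystem π) (X : C) (hX : ¬ IsZero X) :
    ∃ (i : Fin n) (f : P i ⟶ X), f ≠ 0 := by
  obtain ⟨S, q, hS, hq⟩ := h.exists_simple_quotient X hX
  obtain ⟨i, ⟨e⟩⟩ := h.complete S hS
  have := h.projective i
  have := (h.cover i).epi
  refine ⟨i, Projective.factorThru (π i ≫ e.inv) q, fun h0 => ?_⟩
  have h1 := Projective.factorThru_comp (π i ≫ e.inv) q
  rw [h0, zero_comp] at h1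
  apply Simple.not_isZero S
  rw [IsZero.iff_id_eq_zero, ← cancel_epi (π i ≫ e.inv), ← h1]
  simp

theorem isZero_iff (h : IsCoverSystem π) (X : C) :
    IsZero X ↔ ∀ i, Module.finrank k (P i ⟶ X) = 0 := by
  constructor
  · intro hX i
    have : Subsingleton (P i ⟶ X) := ⟨fun a b => hX.eq_of_tgt a b⟩
    exact Module.finrank_zero_of_subsingleton
  · intro h0
    by_contra hX
    obtain ⟨i, f, hf⟩ := h.exists_hom_ne_zero X hX
    have := Module.finrank_zero_iff.1 (h0 i)
    exact hf (Subsingleton.elim _ _)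

-- Take one summand `P i` for each basis vector of Hom(`P i`, `X`). A map from some `P i` to the
-- cokernel lifts to `X`, hence factors through the sum and vanishes. An object receiving no nonzero
-- map from any `P i` is zero.
include k in
theorem exists_epi (h : IsCoverSystem π) (X : C) :
    ∃ (σ : Type) (_ : Fintype σ) (p : σ → Fin n) (f : ∀ s, P (p s) ⟶ X),
      Epi (biproduct.desc f) := by
  refine ⟨Σ i, Fin (Module.finrank k (P i ⟶ X)), inferInstance, fun s => s.1,
    fun s => Module.finBasis k (P s.1 ⟶ X) s.2, ?_⟩
  set d := biproduct.desc fun s : Σ i, Fin (Module.finrank k (P i ⟶ X)) =>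
    (Module.finBasis k (P s.1 ⟶ X) s.2 : P s.1 ⟶ X) with hd
  by_contra hne
  have hc : ¬ IsZero (cokernel d) := fun h0 =>
    hne (Preadditive.epi_of_isZero_cokernel d h0)
  obtain ⟨i, g, hg⟩ := h.exists_hom_ne_zero _ hc
  have := h.projective i
  have key : ∀ f : P i ⟶ X, f ≫ cokernel.π d = 0 := by
    intro f
    rw [← (Module.finBasis k (P i ⟶ X)).sum_repr f, Preadditive.sum_comp]
    refine Finset.sum_eq_zero fun s _ => ?_
    have : (Module.finBasis k (P i ⟶ X) s : P i ⟶ X) =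
      biproduct.ι (fun s : Σ i, Fin (Module.finrank k (P i ⟶ X)) => P s.1) ⟨i, s⟩ ≫ d := by
      simp [hd]
    rw [Linear.smul_comp, this, Category.assoc, cokernel.condition, comp_zero, smul_zero]
  apply hg
  rw [← Projective.factorThru_comp g (cokernel.π d), key]

end IsCoverSystem

end ProjectiveCovers

/-! ### Multiplicities as dimensions of Hom from projective covers -/

section Multiplicity

variable (k : Type w) [Field k] {C : Type u₁} [Category.{v} C] [Abelian C] [Linear k C]

theorem shortExact_of_mono {X Y : C} (f : X ⟶ Y) [Mono f] :
    (ShortComplex.mk f (cokernel.π f) (cokernel.condition f)).ShortExact :=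
  { exact := ShortComplex.exact_cokernel f
    mono_f := inferInstance
    epi_g := inferInstance }

theorem shortExact_of_epi {X Y : C} (f : X ⟶ Y) [Epi f] :
    (ShortComplex.mk (kernel.ι f) f (kernel.condition f)).ShortExact :=
  { exact := ShortComplex.exact_kernel f
    mono_f := inferInstance
    epi_g := inferInstance }

/-- One subobject is contained in another one, with simple quotient. -/
def simpleStep (X : C) : SetRel (Subobject X) (Subobject X) :=
  {p | ∃ h : p.1 ≤ p.2, Simple (cokernel (Subobject.ofLE _ _ h))}

/-- A chain of subobjects with simple quotients from `⊥` to `⊤` is a composition series. -/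
noncomputable def CompSeries.ofRelSeries {X : C} (s : RelSeries (simpleStep X))
    (h₀ : s.head = ⊥) (h₁ : s.last = ⊤) : CompSeries X where
  length := s.length
  obj := s
  le_succ i := (s.step i).1
  bot := h₀
  top := h₁
  simple i := (s.step i).2

variable [∀ X Y : C, Module.Finite k (X ⟶ Y)]

namespace IsCoverSystem

variable {n : ℕ} {V P : Fin n → C} {π : ∀ i, P i ⟶ V i}

-- The number Σ dim Hom(`P i`, `U`) serves as a length: passing to the kernel of a simple quotient
-- of `U` makes it strictly smaller, so the chain can be built downwards.
include k in
theorem exists_relSeries (h : IsCoverSystem π) {X : C} (d : ℕ) : ∀ U : Subobject X,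
    ∑ i, Module.finrank k (P i ⟶ (U : C)) = d →
      ∃ s : RelSeries (simpleStep X), s.head = ⊥ ∧ s.last = U := by
  induction d using Nat.strong_induction_on with
  | _ d ih =>
  intro U hU
  by_cases hz : IsZero (U : C)
  · refine ⟨RelSeries.singleton _ U, ?_, rfl⟩
    have : U.arrow = 0 := hz.eq_of_src _ _
    rw [← Subobject.mk_arrow U]
    exact Subobject.mk_eq_bot_iff_zero.2 this
  obtain ⟨S, q, hS, hq⟩ := h.exists_simple_quotient _ hz
  let U' : Subobject X := Subobject.mk (kernel.ι q ≫ U.arrow)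
  have hle : U' ≤ U := Subobject.mk_le_of_comm (kernel.ι q) rfl
  have hof : Subobject.ofLE U' U hle =
      (Subobject.underlyingIso (kernel.ι q ≫ U.arrow)).hom ≫ kernel.ι q := by
    rw [← cancel_mono U.arrow, Subobject.ofLE_arrow, Category.assoc,
      Subobject.underlyingIso_hom_comp_eq_mk]
  have hSq : Simple (cokernel (Subobject.ofLE U' U hle)) := by
    rw [hof]
    have e₁ := cokernelEpiComp (Subobject.underlyingIso (kernel.ι q ≫ U.arrow)).hom (kernel.ι q)
    have e₂ : cokernel (kernel.ι q) ≅ S :=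
      (cokernelIsCokernel (kernel.ι q)).coconePointUniqueUpToIso
        (Abelian.epiIsCokernelOfKernel _ (limit.isLimit (parallelPair q 0)))
    exact Simple.of_iso (e₁ ≪≫ e₂)
  have hsum : ∑ i, Module.finrank k (P i ⟶ (U : C)) =
      ∑ i, Module.finrank k (P i ⟶ (U' : C)) + ∑ i, Module.finrank k (P i ⟶ S) := by
    rw [← Finset.sum_add_distrib]
    refine Finset.sum_congr rfl fun i _ => ?_
    have := h.projective i
    rw [finrank_hom_of_shortExact k (P i) (shortExact_of_epi q)]
    congr 1
    exact (Linear.homCongr k (Iso.refl (P i))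
      (Subobject.underlyingIso (kernel.ι q ≫ U.arrow)).symm).finrank_eq
  have hpos : ∑ i, Module.finrank k (P i ⟶ S) ≠ 0 := by
    intro h0
    apply Simple.not_isZero S
    rw [h.isZero_iff k]
    intro i
    exact Finset.sum_eq_zero_iff.1 h0 i (Finset.mem_univ i)
  obtain ⟨s, hs₀, hs₁⟩ := ih _ (by omega) U' rfl
  exact ⟨s.snoc U (by rw [hs₁]; exact ⟨hle, hSq⟩), by simpa using hs₀, by simp⟩

include k in
theorem nonempty_compSeries (h : IsCoverSystem π) (X : C) : Nonempty (CompSeries X) := by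
  obtain ⟨s, h₀, h₁⟩ := h.exists_relSeries k _ (⊤ : Subobject X) rfl
  exact ⟨CompSeries.ofRelSeries s h₀ h₁⟩

/-- dim Hom(`P j`, -) is additive on short exact sequences, equals 1 on factors isomorphic to `V j`
and 0 on the other simples. In particular the count is independent of the series. -/
theorem count_eq_finrank [IsAlgClosed k] (h : IsCoverSystem π) {X : C} (s : CompSeries X)
    (j : Fin n) : s.count (V j) = Module.finrank k (P j ⟶ X) := by
  classical
  have := h.projective j
  -- The induction runs over the truncations of the series, counting only the factors below the
  -- `m`-th term.
  have key : ∀ m (hm : m < s.length + 1), Module.finrank k (P j ⟶ (s.obj ⟨m, hm⟩ : C)) =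
      ∑ i : Fin s.length, if i.1 < m ∧ Nonempty (s.factor i ≅ V j) then 1 else 0 := by
    intro m
    induction m with
    | zero =>
      intro hm
      simp only [not_lt_zero, false_and, if_false, Finset.sum_const_zero]
      have h0 : s.obj ⟨0, hm⟩ = ⊥ := s.bot
      rw [h0]
      exact (h.isZero_iff k _).1 ((isZero_zero C).of_iso Subobject.botCoeIsoZero) j
    | succ m ih =>
      intro hm
      have hm' : m < s.length := by omega
      have hstep := finrank_hom_of_shortExact k (P j)
        (shortExact_of_mono (Subobject.ofLE _ _ (s.le_succ ⟨m, hm'⟩)))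
      have hS : Simple (s.factor ⟨m, hm'⟩) := s.simple _
      have hf := h.finrank_hom_simple k j (s.factor ⟨m, hm'⟩)
      refine hstep.trans ?_
      refine (congrArg₂ (· + ·) (ih (by omega)) hf).trans ?_
      have hsingle : (if Nonempty (s.factor ⟨m, hm'⟩ ≅ V j) then 1 else 0) =
          ∑ i : Fin s.length, if i = ⟨m, hm'⟩ then
            (if Nonempty (s.factor i ≅ V j) then 1 else 0) else 0 := by simp
      rw [hsingle, ← Finset.sum_add_distrib]
      refine Finset.sum_congr rfl fun i _ => ?_
      have hi : i = ⟨m, hm'⟩ ↔ i.1 = m := Fin.ext_iff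
      simp only [hi]
      by_cases hV : Nonempty (s.factor i ≅ V j) <;> simp only [hV, and_true, and_false, if_true,
        if_false] <;> split_ifs <;> omega
  have h1 := key s.length (by omega)
  have htop : s.obj ⟨s.length, by omega⟩ = ⊤ := s.top
  rw [htop] at h1
  have e : (((⊤ : Subobject X) : C)) ≅ X := asIso (⊤ : Subobject X).arrow
  rw [← (Linear.homCongr k (Iso.refl (P j)) e).finrank_eq, h1, CompSeries.count,
    Nat.card_eq_fintype_card, Fintype.card_subtype, Finset.card_filter]
  simp

theorem multiplicity_eq_finrank [IsAlgClosed k] (h : IsCoverSystem π) (X : C) (j : Fin n) :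
    multiplicity X (V j) = Module.finrank k (P j ⟶ X) := by
  rw [multiplicity, dif_pos (h.nonempty_compSeries k X), h.count_eq_finrank k]

end IsCoverSystem

end Multiplicity

/-! ### Right exactness tested on morphisms out -/

section RightExact

theorem preservesFiniteColimits_of_shortExact {A : Type u₁} [Category.{v} A] [Abelian A]
    {B : Type u₂} [Category.{v} B] [Abelian B] (F : A ⥤ B) [F.Additive]
    (hepi : ∀ S : ShortComplex A, S.ShortExact → Epi (F.map S.g))
    (hdesc : ∀ S : ShortComplex A, S.ShortExact → ∀ (T : B) (t : F.obj S.X₂ ⟶ T),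
      F.map S.f ≫ t = 0 → ∃ t' : F.obj S.X₃ ⟶ T, F.map S.g ≫ t' = t) :
    PreservesFiniteColimits F := by
  rw [((Functor.preservesFiniteColimits_tfae F).out 3 0 :)]
  refine fun S hS => ⟨?_, hepi S hS⟩
  have := hepi S hS
  refine ShortComplex.exact_of_g_is_cokernel _ ?_
  exact CokernelCofork.IsColimit.ofπ _ _ (fun t ht => (hdesc S hS _ t ht).choose)
    (fun t ht => (hdesc S hS _ t ht).choose_spec)
    (fun t ht b hb =>
      (cancel_epi (F.map S.g)).1 (hb.trans (hdesc S hS _ t ht).choose_spec.symm))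

theorem exists_desc_of_rightExact {A : Type u₁} [Category.{v} A] [Abelian A]
    {B : Type u₂} [Category.{v} B] [Abelian B] (F : A ⥤ B) [F.Additive]
    [PreservesFiniteColimits F] {X Y Z : A} (f : X ⟶ Y) (g : Y ⟶ Z) [Epi g] (w : f ≫ g = 0)
    (hex : (ShortComplex.mk f g w).Exact) {T : B} (t : F.obj Y ⟶ T) (ht : F.map f ≫ t = 0) :
    ∃ t' : F.obj Z ⟶ T, F.map g ≫ t' = t := by
  have hF : PreservesFiniteColimits F := inferInstance
  rw [((Functor.preservesFiniteColimits_tfae F).out 3 1 :)] at hF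
  have h := hF _ ⟨hex, ‹_›⟩
  have : Epi ((ShortComplex.mk f g w).map F).g := h.2
  exact ⟨h.1.desc t ht, h.1.g_desc t ht⟩

end RightExact

/-! ### Copowers by finite-dimensional vector spaces -/

section Copower

attribute [local instance] Abelian.hasFiniteBiproducts

variable (k : Type w) [Field k] {C : Type u₁} [Category.{v} C] [Abelian C] [Linear k C]
  {D : Type u₂} [Category.{v} D] [Abelian D] [Linear k D]
  {U : Type u} [AddCommGroup U] [Module k U] [Module.Finite k U]
  {U' : Type u} [AddCommGroup U'] [Module k U'] [Module.Finite k U']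

variable (U) in
/-- The copower of an object by a finite-dimensional vector space. -/
noncomputable def copow (Y : C) : C := ⨁ fun _ : Fin (Module.finrank k U) => Y

namespace copow

variable (U) in
/-- The coprojections of the copower, as a direct sum. -/
noncomputable def ι (Y : C) (s : Fin (Module.finrank k U)) : Y ⟶ copow k U Y :=
  biproduct.ι (fun _ : Fin (Module.finrank k U) => Y) s

variable (U) in
/-- The projections of the copower, as a direct sum. -/
noncomputable def π (Y : C) (s : Fin (Module.finrank k U)) : copow k U Y ⟶ Y :=
  biproduct.π (fun _ : Fin (Module.finrank k U) => Y) s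

omit [Linear k C] [Module.Finite k U] in
variable (U) in
theorem total (Y : C) : ∑ s, π k U Y s ≫ ι k U Y s = 𝟙 (copow k U Y) :=
  biproduct.total

omit [Linear k C] [Module.Finite k U] in
theorem ι_π (Y : C) (s t : Fin (Module.finrank k U)) :
    ι k U Y s ≫ π k U Y t = if s = t then 𝟙 Y else 0 := by
  split_ifs with h
  · subst h
    exact biproduct.ι_π_self _ _
  · exact biproduct.ι_π_ne _ h

variable (U) in
/-- The coprojections of the copower, indexed by all vectors. -/
noncomputable def ins (Y : C) : U →ₗ[k] (Y ⟶ copow k U Y) where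
  toFun u := ∑ s, (Module.finBasis k U).repr u s • ι k U Y s
  map_add' u u' := by
    rw [← Finset.sum_add_distrib]
    exact Finset.sum_congr rfl fun s _ => by simp [add_smul]
  map_smul' c u := by
    rw [Finset.smul_sum]
    exact Finset.sum_congr rfl fun s _ => by simp [mul_smul]

theorem ins_basis (Y : C) (s : Fin (Module.finrank k U)) :
    ins k U Y (Module.finBasis k U s) = ι k U Y s := by
  simp only [ins, LinearMap.coe_mk, AddHom.coe_mk, Module.Basis.repr_self]
  rw [Finset.sum_eq_single s]
  · simp
  · intro t _ ht
    simp [Ne.symm ht]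
  · simp

theorem ins_π (Y : C) (u : U) (s : Fin (Module.finrank k U)) :
    ins k U Y u ≫ π k U Y s = (Module.finBasis k U).repr u s • 𝟙 Y := by
  simp only [ins, LinearMap.coe_mk, AddHom.coe_mk]
  rw [Preadditive.sum_comp, Finset.sum_eq_single s]
  · simp [ι_π]
  · intro b _ hb
    simp [ι_π, hb]
  · simp

section functor

variable (H : C ⥤ D) [H.Additive] [H.Linear k]

-- An additive functor preserves finite direct sums, so the coprojections stay jointly epimorphic
-- after applying `H`.
omit [Linear k D] [H.Linear k] in
theorem map_hom_ext {Y : C} {T : D} {f g : H.obj (copow k U Y) ⟶ T}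
    (h : ∀ u, H.map (ins k U Y u) ≫ f = H.map (ins k U Y u) ≫ g) : f = g := by
  rw [← Category.id_comp f, ← Category.id_comp g, ← H.map_id]
  rw [← total, H.map_sum, Preadditive.sum_comp, Preadditive.sum_comp]
  refine Finset.sum_congr rfl fun s _ => ?_
  rw [H.map_comp, Category.assoc, Category.assoc, ← ins_basis, h]

/-- Morphisms from the image of a copower under a linear functor. -/
noncomputable def mapDesc {Y : C} {T : D} (φ : U →ₗ[k] (H.obj Y ⟶ T)) :
    H.obj (copow k U Y) ⟶ T :=
  ∑ s, H.map (π k U Y s) ≫ φ (Module.finBasis k U s)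

omit [H.Additive] in
theorem map_ins_mapDesc {Y : C} {T : D} (φ : U →ₗ[k] (H.obj Y ⟶ T)) (u : U) :
    H.map (ins k U Y u) ≫ mapDesc k H φ = φ u := by
  conv_rhs => rw [← (Module.finBasis k U).sum_repr u, map_sum]
  rw [mapDesc, Preadditive.comp_sum]
  refine Finset.sum_congr rfl fun s _ => ?_
  rw [← Category.assoc, ← H.map_comp]
  rw [ins_π, H.map_smul, H.map_id, Linear.smul_comp, Category.id_comp, map_smul]

end functor

theorem hom_ext {Y T : C} {f g : copow k U Y ⟶ T}
    (h : ∀ u, ins k U Y u ≫ f = ins k U Y u ≫ g) : f = g :=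
  map_hom_ext k (𝟭 C) h

/-- The universal property of the copower. -/
noncomputable def desc {Y T : C} (φ : U →ₗ[k] (Y ⟶ T)) : copow k U Y ⟶ T :=
  mapDesc k (𝟭 C) φ

@[simp]
theorem ins_desc {Y T : C} (φ : U →ₗ[k] (Y ⟶ T)) (u : U) : ins k U Y u ≫ desc k φ = φ u :=
  map_ins_mapDesc k (𝟭 C) φ u

/-- The functoriality of the copower. -/
noncomputable def map (g : U →ₗ[k] U') {Y Y' : C} (h : Y ⟶ Y') :
    copow k U Y ⟶ copow k U' Y' :=
  desc k ((Linear.leftComp k _ h).comp ((ins k U' Y').comp g))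

@[simp]
theorem ins_map (g : U →ₗ[k] U') {Y Y' : C} (h : Y ⟶ Y') (u : U) :
    ins k U Y u ≫ map k g h = h ≫ ins k U' Y' (g u) := by
  simp [map]

@[simp]
theorem ins_map_assoc (g : U →ₗ[k] U') {Y Y' : C} (h : Y ⟶ Y') (u : U) {T : C}
    (t : copow k U' Y' ⟶ T) : ins k U Y u ≫ map k g h ≫ t = h ≫ ins k U' Y' (g u) ≫ t := by
  rw [← Category.assoc, ins_map, Category.assoc]

omit [Module.Finite k U] in
theorem finrank_hom [∀ X Y : C, Module.Finite k (X ⟶ Y)] (X Y : C) :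
    Module.finrank k (X ⟶ copow k U Y) = Module.finrank k U * Module.finrank k (X ⟶ Y) := by
  let e : (X ⟶ copow k U Y) ≃ₗ[k] (Fin (Module.finrank k U) → (X ⟶ Y)) :=
    { toFun := fun f s => f ≫ biproduct.π (fun _ => Y) s
      invFun := fun f => biproduct.lift f
      map_add' := fun f g => by ext s; exact Preadditive.add_comp _ _ _ _ _ _
      map_smul' := fun c f => by ext s; exact Linear.smul_comp _ _ _ _ _ _
      left_inv := fun f => by
        apply biproduct.hom_ext
        intro s
        exact biproduct.lift_π _ _
      right_inv := fun f => by
        ext s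
        exact biproduct.lift_π _ _ }
  rw [e.finrank_eq, Module.finrank_pi_fintype]
  simp

end copow

end Copower

/-! ### Functors on the full subcategory of the projective covers -/

section CoverIndex

variable {C : Type u₁} [Category.{v} C] {n : ℕ}

/-- The category on `Fin n` induced by a family of objects. -/
structure CoverIdx (P : Fin n → C) : Type where
  /-- The object with a given index. -/
  of ::
  /-- The index of an object. -/
  idx : Fin n

instance (P : Fin n → C) : Category.{v} (CoverIdx P) where
  Hom a b := P a.idx ⟶ P b.idx
  id a := 𝟙 (P a.idx)
  comp f g := f ≫ g

/-- Functors on the opposite of the category induced by a family of objects. -/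
abbrev CoverMod (P : Fin n → C) := (CoverIdx P)ᵒᵖ ⥤ C

variable {P : Fin n → C}

namespace CoverMod

/-- The value at an index. -/
abbrev val (M : CoverMod P) (a : Fin n) : C := M.obj (Opposite.op (CoverIdx.of a))

/-- The action of a morphism. -/
def act (M : CoverMod P) {a b : Fin n} (r : P a ⟶ P b) : M.val b ⟶ M.val a :=
  M.map (Quiver.Hom.op (show CoverIdx.of a ⟶ CoverIdx.of b from r))

/-- The component of a morphism at an index. -/
abbrev comp {M N : CoverMod P} (f : M ⟶ N) (a : Fin n) : M.val a ⟶ N.val a :=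
  f.app (Opposite.op (CoverIdx.of a))

theorem act_id (M : CoverMod P) (a : Fin n) : M.act (𝟙 (P a)) = 𝟙 (M.val a) := M.map_id _

theorem act_comp (M : CoverMod P) {a b c : Fin n} (r : P a ⟶ P b) (s : P b ⟶ P c) :
    M.act (r ≫ s) = M.act s ≫ M.act r :=
  M.map_comp (Quiver.Hom.op (show CoverIdx.of b ⟶ CoverIdx.of c from s))
    (Quiver.Hom.op (show CoverIdx.of a ⟶ CoverIdx.of b from r))

theorem comp_act {M N : CoverMod P} (f : M ⟶ N) {a b : Fin n} (r : P a ⟶ P b) :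
    comp f b ≫ N.act r = M.act r ≫ comp f a := (f.naturality _).symm

theorem hom_ext {M N : CoverMod P} {f g : M ⟶ N} (h : ∀ a, comp f a = comp g a) : f = g := by
  ext a
  exact h a.unop.idx

/-- Constructor for functors on the opposite of the category induced by a family of objects. -/
def mk (val : Fin n → C) (act : ∀ {a b : Fin n}, (P a ⟶ P b) → (val b ⟶ val a))
    (act_id : ∀ a, act (𝟙 (P a)) = 𝟙 (val a))
    (act_comp : ∀ {a b c : Fin n} (r : P a ⟶ P b) (s : P b ⟶ P c),
      act (r ≫ s) = act s ≫ act r) : CoverMod P where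
  obj a := val a.unop.idx
  map r := act r.unop
  map_id a := act_id a.unop.idx
  map_comp r s := act_comp s.unop r.unop

/-- Constructor for morphisms between functors on the opposite of the category induced by a
family of objects. -/
def homMk {M N : CoverMod P} (f : ∀ a, M.val a ⟶ N.val a)
    (hf : ∀ {a b : Fin n} (r : P a ⟶ P b), f b ≫ N.act r = M.act r ≫ f a) : M ⟶ N where
  app a := f a.unop.idx
  naturality _ _ r := (hf r.unop).symm

end CoverMod

end CoverIndex

/-! ### The concrete bifunctor `a ↦ Hom(P a, X) ⊗ Y` and its right exactness -/

section CoverBox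

variable (k : Type w) [Field k] {C : Type u₁} [Category.{v} C] [Abelian C] [Linear k C] {n : ℕ}
  [∀ X Y : C, Module.Finite k (X ⟶ Y)]

/-- The functor `a ↦ Hom(P a, X) ⊗ Y`. -/
noncomputable def coverBoxObj (P : Fin n → C) (X Y : C) : CoverMod P :=
  CoverMod.mk (fun a => copow k (P a ⟶ X) Y)
    (fun r => copow.map k (Linear.leftComp k X r) (𝟙 Y))
    (fun a => copow.hom_ext k fun u => by simp)
    (fun r s => copow.hom_ext k fun u => by simp)

variable {k} in
/-- The element of the functor `a ↦ Hom(P a, X) ⊗ Y` given by a morphism `P a ⟶ X`. -/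
noncomputable def coverBoxObj.ins (P : Fin n → C) {X : C} (Y : C) {a : Fin n} :
    (P a ⟶ X) →ₗ[k] (Y ⟶ (coverBoxObj k P X Y).val a) :=
  copow.ins k (P a ⟶ X) Y

namespace coverBoxObj

variable {P : Fin n → C}

@[simp]
theorem ins_act {X Y : C} {a b : Fin n} (u : P b ⟶ X) (r : P a ⟶ P b) :
    ins P Y u ≫ (coverBoxObj k P X Y).act r = ins (k := k) P Y (r ≫ u) :=
  (copow.ins_map k (Linear.leftComp k X r) (𝟙 Y) u).trans (Category.id_comp _)

@[simp]
theorem ins_act_assoc {X Y T : C} {a b : Fin n} (u : P b ⟶ X) (r : P a ⟶ P b)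
    (t : (coverBoxObj k P X Y).val a ⟶ T) :
    ins P Y u ≫ (coverBoxObj k P X Y).act r ≫ t = ins (k := k) P Y (r ≫ u) ≫ t := by
  rw [← Category.assoc, ins_act]

variable {k}

theorem hom_ext_val {X Y T : C} {a : Fin n} {f g : (coverBoxObj k P X Y).val a ⟶ T}
    (h : ∀ u : P a ⟶ X, ins P Y u ≫ f = ins P Y u ≫ g) : f = g := copow.hom_ext k h

/-- Morphisms out of a value of the functor `a ↦ Hom(P a, X) ⊗ Y`. -/
noncomputable def descVal {X Y T : C} {a : Fin n} (φ : (P a ⟶ X) →ₗ[k] (Y ⟶ T)) :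
    (coverBoxObj k P X Y).val a ⟶ T := copow.desc k φ

@[simp]
theorem ins_descVal {X Y T : C} {a : Fin n} (φ : (P a ⟶ X) →ₗ[k] (Y ⟶ T)) (u : P a ⟶ X) :
    ins P Y u ≫ descVal φ = φ u := copow.ins_desc k φ u

@[simp]
theorem ins_descVal_assoc {X Y T Z : C} {a : Fin n} (φ : (P a ⟶ X) →ₗ[k] (Y ⟶ T))
    (u : P a ⟶ X) (t : T ⟶ Z) : ins P Y u ≫ descVal φ ≫ t = φ u ≫ t := by
  rw [← Category.assoc, ins_descVal]

theorem hom_ext {X Y : C} {M : CoverMod P} {f g : coverBoxObj k P X Y ⟶ M}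
    (h : ∀ a (u : P a ⟶ X), ins P Y u ≫ CoverMod.comp f a = ins P Y u ≫ CoverMod.comp g a) :
    f = g := CoverMod.hom_ext fun a => hom_ext_val (h a)

/-- Morphisms out of the functor `a ↦ Hom(P a, X) ⊗ Y`. -/
noncomputable def desc {X Y : C} {M : CoverMod P} (φ : ∀ a, (P a ⟶ X) →ₗ[k] (Y ⟶ M.val a))
    (hφ : ∀ {a b : Fin n} (r : P a ⟶ P b) (u : P b ⟶ X), φ b u ≫ M.act r = φ a (r ≫ u)) :
    coverBoxObj k P X Y ⟶ M :=
  CoverMod.homMk (fun a => descVal (φ a)) fun r => hom_ext_val fun u => by simp [hφ]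

@[simp]
theorem ins_desc {X Y : C} {M : CoverMod P} (φ : ∀ a, (P a ⟶ X) →ₗ[k] (Y ⟶ M.val a))
    (hφ : ∀ {a b : Fin n} (r : P a ⟶ P b) (u : P b ⟶ X), φ b u ≫ M.act r = φ a (r ≫ u))
    (a : Fin n) (u : P a ⟶ X) :
    ins P Y u ≫ CoverMod.comp (desc φ hφ) a = φ a u := ins_descVal (φ a) u

end coverBoxObj

variable {P : Fin n → C}

/-- The functoriality of the functors `a ↦ Hom(P a, X) ⊗ Y`. -/
noncomputable def coverBoxMap {X X' Y Y' : C} (f : X ⟶ X') (g : Y ⟶ Y') :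
    coverBoxObj k P X Y ⟶ coverBoxObj k P X' Y' :=
  coverBoxObj.desc (fun a => (Linear.leftComp k _ g).comp
    ((coverBoxObj.ins P Y').comp (Linear.rightComp k (P a) f))) (by simp)

@[simp]
theorem coverBoxObj.ins_map {X X' Y Y' : C} (f : X ⟶ X') (g : Y ⟶ Y') (a : Fin n)
    (u : P a ⟶ X) : ins P Y u ≫ CoverMod.comp (coverBoxMap k f g) a =
      g ≫ ins (k := k) P Y' (u ≫ f) := by
  simp [coverBoxMap]

@[simp]
theorem coverBoxObj.ins_map_assoc {X X' Y Y' T : C} (f : X ⟶ X') (g : Y ⟶ Y') (a : Fin n)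
    (u : P a ⟶ X) (t : (coverBoxObj k P X' Y').val a ⟶ T) :
    ins P Y u ≫ CoverMod.comp (coverBoxMap k f g) a ≫ t =
      g ≫ ins (k := k) P Y' (u ≫ f) ≫ t := by
  rw [← Category.assoc, ins_map, Category.assoc]

variable (P) in
/-- The bifunctor which maps `(X, Y)` to the functor `a ↦ Hom(P a, X) ⊗ Y`. -/
noncomputable def coverBox : C ⥤ C ⥤ CoverMod P where
  obj X :=
    { obj := fun Y => coverBoxObj k P X Y
      map := fun g => coverBoxMap k (𝟙 X) g
      map_id := fun Y => coverBoxObj.hom_ext fun a u => by simp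
      map_comp := fun f g => coverBoxObj.hom_ext fun a u => by simp }
  map f :=
    { app := fun Y => coverBoxMap k f (𝟙 Y)
      naturality := fun Y Y' g => coverBoxObj.hom_ext fun a u => by simp }
  map_id X := by
    ext Y : 2
    exact coverBoxObj.hom_ext fun a u => by simp
  map_comp f g := by
    ext Y : 2
    exact coverBoxObj.hom_ext fun a u => by simp

variable {k}

/-- Colimits in a functor category are pointwise, so right exactness is checked at each index. -/
theorem preservesFiniteColimits_coverMod {A : Type u₂} [Category.{v} A] [Abelian A]
    (F : A ⥤ CoverMod P) [F.Additive]
    (hepi : ∀ S : ShortComplex A, S.ShortExact → ∀ a, Epi (CoverMod.comp (F.map S.g) a))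
    (hdesc : ∀ S : ShortComplex A, S.ShortExact → ∀ a (T : C) (t : (F.obj S.X₂).val a ⟶ T),
      CoverMod.comp (F.map S.f) a ≫ t = 0 →
        ∃ t' : (F.obj S.X₃).val a ⟶ T, CoverMod.comp (F.map S.g) a ≫ t' = t) :
    PreservesFiniteColimits F := by
  refine preservesFiniteColimits_of_evaluation F fun a => ?_
  have : (F ⋙ (evaluation _ _).obj a).Additive :=
    ⟨fun {X Y f g} => by simp [F.map_add]⟩
  exact preservesFiniteColimits_of_shortExact (F ⋙ (evaluation _ _).obj a)
    (fun S hS => hepi S hS a.unop.idx) (fun S hS => hdesc S hS a.unop.idx)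

theorem CoverMod.comp_add {M N : CoverMod P} (f g : M ⟶ N) (a : Fin n) :
    CoverMod.comp (f + g) a = CoverMod.comp f a + CoverMod.comp g a := rfl

omit [∀ X Y : C, Module.Finite k (X ⟶ Y)] in
theorem CoverMod.comp_smul {M N : CoverMod P} (c : k) (f : M ⟶ N) (a : Fin n) :
    CoverMod.comp (c • f) a = c • CoverMod.comp f a := rfl

section

variable {S : ShortComplex C} (hS : S.ShortExact) (a : Fin n)
include hS

theorem epi_coverBoxMap_right (X : C) :
    Epi (CoverMod.comp (coverBoxMap (P := P) k (𝟙 X) S.g) a) := by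
  have := hS.epi_g
  refine ⟨fun s t hst => coverBoxObj.hom_ext_val fun u => ?_⟩
  rw [← cancel_epi S.g]
  have := coverBoxObj.ins P S.X₂ u ≫= hst
  simpa using this

theorem exists_coverBoxMap_right_comp {X T : C} (t : (coverBoxObj k P X S.X₂).val a ⟶ T)
    (ht : CoverMod.comp (coverBoxMap k (𝟙 X) S.f) a ≫ t = 0) :
    ∃ t', CoverMod.comp (coverBoxMap k (𝟙 X) S.g) a ≫ t' = t := by
  have := hS.epi_g
  have h0 : ∀ u : P a ⟶ X, S.f ≫ coverBoxObj.ins P S.X₂ u ≫ t = 0 := fun u => by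
    have := coverBoxObj.ins P S.X₁ u ≫= ht
    simpa using this
  let φ : (P a ⟶ X) →ₗ[k] (S.X₃ ⟶ T) :=
    { toFun := fun u => hS.exact.desc (coverBoxObj.ins P S.X₂ u ≫ t) (h0 u)
      map_add' := fun u u' => by simp [← cancel_epi S.g]
      map_smul' := fun c u => by simp [← cancel_epi S.g] }
  refine ⟨coverBoxObj.descVal φ, coverBoxObj.hom_ext_val fun u => ?_⟩
  rw [coverBoxObj.ins_map_assoc, Category.comp_id, coverBoxObj.ins_descVal]
  exact hS.exact.g_desc _ _

variable [∀ a, Projective (P a)]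

theorem epi_coverBoxMap_left (Y : C) :
    Epi (CoverMod.comp (coverBoxMap (P := P) k S.g (𝟙 Y)) a) := by
  have := hS.epi_g
  refine ⟨fun s t hst => coverBoxObj.hom_ext_val fun u => ?_⟩
  have := coverBoxObj.ins P Y (Projective.factorThru u S.g) ≫= hst
  simpa using this

theorem exists_coverBoxMap_left_comp {Y T : C} (t : (coverBoxObj k P S.X₂ Y).val a ⟶ T)
    (ht : CoverMod.comp (coverBoxMap k S.f (𝟙 Y)) a ≫ t = 0) :
    ∃ t', CoverMod.comp (coverBoxMap k S.g (𝟙 Y)) a ≫ t' = t := by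
  have := hS.epi_g
  have h0 : ∀ u : P a ⟶ S.X₁, coverBoxObj.ins P Y (u ≫ S.f) ≫ t = 0 := fun u => by
    have := coverBoxObj.ins P Y u ≫= ht
    simpa using this
  let γ : (P a ⟶ S.X₂) →ₗ[k] (P a ⟶ S.X₃) := Linear.rightComp k (P a) S.g
  -- Projectivity of `P a` makes `γ` surjective, so it has a linear section `σ`. The descended map
  -- is `t` on `σ u`; another lift differs from `σ u` by a map through `S.X₁`, on which `t`
  -- vanishes.
  obtain ⟨σ, hσ⟩ := γ.exists_rightInverse_of_surjective
    (LinearMap.range_eq_top.2 fun u => ⟨Projective.factorThru u S.g, by simp [γ]⟩)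
  let φ : (P a ⟶ S.X₃) →ₗ[k] (Y ⟶ T) :=
    (Linear.rightComp k Y t).comp ((coverBoxObj.ins P Y).comp σ)
  refine ⟨coverBoxObj.descVal φ, coverBoxObj.hom_ext_val fun u => ?_⟩
  have h2 : (σ (u ≫ S.g) - u) ≫ S.g = 0 := by
    rw [Preadditive.sub_comp, sub_eq_zero]
    exact LinearMap.congr_fun hσ (u ≫ S.g)
  have := hS.mono_f
  have h3 := h0 (hS.exact.lift _ h2)
  rw [hS.exact.lift_f, map_sub, Preadditive.sub_comp, sub_eq_zero] at h3
  rw [coverBoxObj.ins_map_assoc, Category.id_comp, coverBoxObj.ins_descVal]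
  exact h3

end

theorem coverBoxMap_add_right {X Y Y' : C} (f g : Y ⟶ Y') :
    coverBoxMap (P := P) k (𝟙 X) (f + g) = coverBoxMap k (𝟙 X) f + coverBoxMap k (𝟙 X) g :=
  coverBoxObj.hom_ext fun a u => by simp [CoverMod.comp_add, -NatTrans.app_add]

theorem coverBoxMap_smul_right {X Y Y' : C} (c : k) (f : Y ⟶ Y') :
    coverBoxMap (P := P) k (𝟙 X) (c • f) = c • coverBoxMap k (𝟙 X) f :=
  coverBoxObj.hom_ext fun a u => by simp [CoverMod.comp_smul, -NatTrans.app_smul]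

theorem coverBoxMap_add_left {X X' Y : C} (f g : X ⟶ X') :
    coverBoxMap (P := P) k (f + g) (𝟙 Y) = coverBoxMap k f (𝟙 Y) + coverBoxMap k g (𝟙 Y) :=
  coverBoxObj.hom_ext fun a u => by simp [CoverMod.comp_add, -NatTrans.app_add]

theorem coverBoxMap_smul_left {X X' Y : C} (c : k) (f : X ⟶ X') :
    coverBoxMap (P := P) k (c • f) (𝟙 Y) = c • coverBoxMap k f (𝟙 Y) :=
  coverBoxObj.hom_ext fun a u => by simp [CoverMod.comp_smul, -NatTrans.app_smul]

theorem isRex_coverBox_obj (X : C) : IsRex k ((coverBox k P).obj X) := by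
  have hadd : ((coverBox k P).obj X).Additive := ⟨coverBoxMap_add_right _ _⟩
  exact ⟨hadd, ⟨fun f c => coverBoxMap_smul_right c f⟩,
    preservesFiniteColimits_coverMod _ (fun S hS a => epi_coverBoxMap_right hS a X)
      (fun S hS a T t ht => exists_coverBoxMap_right_comp hS a t ht)⟩

theorem isRex_coverBox_flip_obj [∀ a, Projective (P a)] (Y : C) :
    IsRex k ((coverBox k P).flip.obj Y) := by
  have hadd : ((coverBox k P).flip.obj Y).Additive := ⟨coverBoxMap_add_left _ _⟩
  exact ⟨hadd, ⟨fun f c => coverBoxMap_smul_left c f⟩,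
    preservesFiniteColimits_coverMod _ (fun S hS a => epi_coverBoxMap_left hS a Y)
      (fun S hS a T t ht => exists_coverBoxMap_left_comp hS a t ht)⟩

theorem isBirex_coverBox [∀ a, Projective (P a)] : IsBirex k (coverBox k P) :=
  ⟨isRex_coverBox_obj, isRex_coverBox_flip_obj⟩

end CoverBox

/-! ### The universal property for targets in other universes -/

section Universality

variable {k : Type w} [Field k]
  {C₁ : Type u₁} [Category.{v} C₁] [Preadditive C₁] [Linear k C₁]
  {C₂ : Type u₂} [Category.{v} C₂] [Preadditive C₂] [Linear k C₂]
  {D : Type u₃} [Category.{v} D] [Preadditive D] [Linear k D]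

/-- A category equivalent to an abelian one, with the induced linear structure, is abelian. -/
@[reducible]
noncomputable def abelianInducedCategory {E : Type u} [Category.{v} E] [Abelian E] {T : Type u₁}
    (o : T → E) [(inducedFunctor o).EssSurj] : Abelian (InducedCategory E o) := by
  have : (inducedFunctor o).IsEquivalence := { }
  have : HasFiniteProducts (InducedCategory E o) :=
    ⟨fun _ => Adjunction.hasLimitsOfShape_of_equivalence (inducedFunctor o)⟩
  exact abelianOfEquivalence (inducedFunctor o)

variable {E : Type u} [Category.{v} E] [Abelian E] [Linear k E]

theorem isRex_of_isEquivalence {A : Type u₁} [Category.{v} A] [Preadditive A] [Linear k A]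
    {B : Type u₂} [Category.{v} B] [Preadditive B] [Linear k B] (F : A ⥤ B) [F.IsEquivalence]
    [F.Additive] [F.Linear k] : IsRex k F :=
  ⟨inferInstance, inferInstance, inferInstance⟩

theorem isRex_inv {A : Type u₁} [Category.{v} A] [Preadditive A] [Linear k A]
    {B : Type u₂} [Category.{v} B] [Preadditive B] [Linear k B] (F : A ⥤ B) [F.IsEquivalence]
    [F.Additive] [F.Linear k] : IsRex k F.inv := by
  have : F.asEquivalence.functor.Additive := ‹F.Additive›
  have : F.asEquivalence.functor.Linear k := ‹F.Linear k›
  have : F.inv.Additive := F.asEquivalence.inverse_additive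
  have : F.inv.Linear k := CategoryTheory.Equivalence.inverseLinear k F.asEquivalence
  exact isRex_of_isEquivalence _

namespace IsDeligneProduct

variable {box : C₁ ⥤ C₂ ⥤ D} (hbox : IsDeligneProduct k box)
  {T : Type (max u₃ (v + 1))} (o : T → E) [(inducedFunctor o).EssSurj]
include hbox o

/-- The universal property of a Deligne tensor product extends to all target categories that have
an essentially surjective family of objects of the right size: existence of factorizations. -/
theorem exists_factorization (B : C₁ ⥤ C₂ ⥤ E) (hB : IsBirex k B) :
    ∃ G : D ⥤ E, IsRex k G ∧ Nonempty ((precomp box E).obj G ≅ B) := by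
  have : (inducedFunctor o).IsEquivalence := { }
  let := abelianInducedCategory o
  have := hbox.universal (InducedCategory E o)
  have hi : IsRex k (inducedFunctor o).inv := isRex_inv _
  -- The bifunctor is moved to the equivalent category whose objects are `T`, factored there, and
  -- the factorization is moved back.
  let B' : Birex k C₁ C₂ (InducedCategory E o) :=
    ⟨(precomp B _).obj (inducedFunctor o).inv, hB.precomp hi⟩
  obtain ⟨G, ⟨e⟩⟩ := Functor.EssSurj.mem_essImage (F := rexPrecomp hbox.birex (InducedCategory E o)) B'
  refine ⟨G.obj ⋙ inducedFunctor o, G.property.comp (isRex_of_isEquivalence _), ⟨?_⟩⟩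
  let e₀ : (precomp box _).obj G.obj ≅ (precomp B _).obj (inducedFunctor o).inv :=
    (ObjectProperty.ι _).mapIso e
  exact ((Functor.whiskeringRight C₁ _ _).obj ((Functor.whiskeringRight C₂ _ _).obj
      (inducedFunctor o))).mapIso e₀ ≪≫
    Functor.isoWhiskerLeft B ((Functor.whiskeringRight C₂ E E).mapIso
      (inducedFunctor o).asEquivalence.counitIso) ≪≫
    NatIso.ofComponents (fun X => Functor.rightUnitor (B.obj X))

/-- The universal property of a Deligne tensor product extends to all target categories that have
an essentially surjective family of objects of the right size: isomorphisms. -/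
theorem nonempty_iso (F G : D ⥤ E) (hF : IsRex k F) (hG : IsRex k G)
    (e : (precomp box E).obj F ≅ (precomp box E).obj G) : Nonempty (F ≅ G) := by
  have : (inducedFunctor o).IsEquivalence := { }
  let := abelianInducedCategory o
  have := hbox.universal (InducedCategory E o)
  have hi : IsRex k (inducedFunctor o).inv := isRex_inv _
  let F' : Rex k D (InducedCategory E o) := ⟨F ⋙ (inducedFunctor o).inv, hF.comp hi⟩
  let G' : Rex k D (InducedCategory E o) := ⟨G ⋙ (inducedFunctor o).inv, hG.comp hi⟩
  let e' : (rexPrecomp hbox.birex (InducedCategory E o)).obj F' ≅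
      (rexPrecomp hbox.birex (InducedCategory E o)).obj G' :=
    (ObjectProperty.fullyFaithfulι _).preimageIso
      (((Functor.whiskeringRight C₁ _ _).obj ((Functor.whiskeringRight C₂ _ _).obj
        (inducedFunctor o).inv)).mapIso e)
  let e'' : F ⋙ (inducedFunctor o).inv ≅ G ⋙ (inducedFunctor o).inv :=
    (ObjectProperty.ι _).mapIso
      ((rexPrecomp hbox.birex (InducedCategory E o)).preimageIso e')
  exact ⟨((Functor.FullyFaithful.ofFullyFaithful
    (inducedFunctor o).inv).whiskeringRight D).preimageIso e''⟩

end IsDeligneProduct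

end Universality

/-! ### The two targets needed: `D` itself and `CoverMod P` -/

section Targets

variable {k : Type w} [Field k]
  {C : Type u₁} [Category.{v} C] [Abelian C] [Linear k C]
  {D : Type u₂} [Category.{v} D] [Abelian D] [Linear k D]

/-- Right exact functors that agree on `box` are isomorphic. This will identify a composite through
`CoverMod P` with the identity. -/
theorem IsDeligneProduct.nonempty_iso_id {box : C ⥤ C ⥤ D} (hbox : IsDeligneProduct k box)
    (G : D ⥤ D) (hG : IsRex k G) (e : (precomp box D).obj G ≅ box) : Nonempty (G ≅ 𝟭 D) := by
  let o : ULift.{max u₂ (v + 1)} D → D := ULift.down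
  have : (inducedFunctor o).EssSurj := ⟨fun X => ⟨⟨X⟩, ⟨Iso.refl X⟩⟩⟩
  exact hbox.nonempty_iso o G (𝟭 D) hG (isRex_of_isEquivalence _)
    (e ≪≫ NatIso.ofComponents (fun X => (Functor.rightUnitor (box.obj X)).symm)
      (fun f => by ext Y; simp [precomp]))

theorem IsDeligneProduct.exists_factorization_coverMod [IsFiniteAbelian k C] {box : C ⥤ C ⥤ D}
    (hbox : IsDeligneProduct k box) {n : ℕ} (P : Fin n → C) (B : C ⥤ C ⥤ CoverMod P)
    (hB : IsBirex k B) :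
    ∃ G : D ⥤ CoverMod P, IsRex k G ∧ Nonempty ((precomp box _).obj G ≅ B) := by
  obtain ⟨T, _, ⟨e⟩⟩ := IsFiniteAbelian.exists_small_model k C
  -- The objects of `C` may lie in a universe unrelated to that of `D`; functors into a small model
  -- of `C` fit the universe of the universal property.
  let o : ULift.{max u₂ (v + 1)} ((CoverIdx P)ᵒᵖ ⥤ T) → CoverMod P := fun M => M.down ⋙ e.functor
  have : (inducedFunctor o).EssSurj := ⟨fun M => ⟨⟨M ⋙ e.inverse⟩,
    ⟨Functor.associator _ _ _ ≪≫ Functor.isoWhiskerLeft M e.counitIso ≪≫ M.rightUnitor⟩⟩⟩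
  exact hbox.exists_factorization o B hB

end Targets

/-! ### Maps out of `H X` are determined on projective covers -/

section Descent

attribute [local instance] Abelian.hasFiniteBiproducts

variable (k : Type w) [Field k]
  {C : Type u₁} [Category.{v} C] [Abelian C] [Linear k C] [∀ X Y : C, Module.Finite k (X ⟶ Y)]
  {D : Type u₂} [Category.{v} D] [Abelian D]
  {n : ℕ} {V P : Fin n → C} {π : ∀ i, P i ⟶ V i} (h : IsCoverSystem π)
  (H : C ⥤ D) [H.Additive] [PreservesFiniteColimits H]

include k h

theorem IsCoverSystem.map_hom_ext {X : C} {T : D} {s t : H.obj X ⟶ T}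
    (hst : ∀ a (f : P a ⟶ X), H.map f ≫ s = H.map f ≫ t) : s = t := by
  obtain ⟨σ, _, p, f, hf⟩ := h.exists_epi k X
  rw [← cancel_epi (H.map (biproduct.desc f)), biproduct.desc_eq, H.map_sum, Preadditive.sum_comp,
    Preadditive.sum_comp]
  refine Finset.sum_congr rfl fun x _ => ?_
  rw [H.map_comp, Category.assoc, Category.assoc, hst]

/-- Morphisms out of `H X` for a right exact functor `H` are compatible families of morphisms
indexed by the morphisms from the projective objects `P a` to `X`. -/
theorem IsCoverSystem.exists_descent {X : C} {T : D}
    (t : ∀ a, (P a ⟶ X) → (H.obj (P a) ⟶ T))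
    (hadd : ∀ a (f g : P a ⟶ X), t a (f + g) = t a f + t a g)
    (hcomp : ∀ a b (r : P a ⟶ P b) (f : P b ⟶ X), t a (r ≫ f) = H.map r ≫ t b f) :
    ∃ t' : H.obj X ⟶ T, ∀ a (f : P a ⟶ X), H.map f ≫ t' = t a f := by
  obtain ⟨σ, _, p, f, hf⟩ := h.exists_epi k X
  let s₀ : H.obj (⨁ fun s => P (p s)) ⟶ T :=
    ∑ s, H.map (biproduct.π (fun s => P (p s)) s) ≫ t (p s) (f s)
  have hs₀ : ∀ a (y : P a ⟶ ⨁ fun s => P (p s)),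
      H.map y ≫ s₀ = t a (y ≫ biproduct.desc f) := by
    intro a y
    let τ : (P a ⟶ X) →+ (H.obj (P a) ⟶ T) := AddMonoidHom.mk' (t a) (hadd a)
    have hτ : t a (y ≫ biproduct.desc f) = τ (y ≫ biproduct.desc f) := rfl
    rw [hτ, biproduct.desc_eq, Preadditive.comp_sum, Preadditive.comp_sum, map_sum]
    refine Finset.sum_congr rfl fun x _ => ?_
    rw [← H.map_comp_assoc, ← hcomp, Category.assoc]
    rfl
  have h0 : ∀ a, t a 0 = 0 := fun a => by simpa using hadd a 0 0
  -- The kernel need not be projective, but it is again covered by objects `P a`, on which `hs₀`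
  -- applies. Right exactness of `H` then lets `s₀` descend.
  have hker : H.map (kernel.ι (biproduct.desc f)) ≫ s₀ = 0 := by
    refine h.map_hom_ext k H fun a y => ?_
    rw [← H.map_comp_assoc, hs₀, Category.assoc, kernel.condition, comp_zero, comp_zero, h0]
  obtain ⟨t', ht'⟩ := exists_desc_of_rightExact H (kernel.ι (biproduct.desc f)) (biproduct.desc f)
    (kernel.condition _) (ShortComplex.exact_kernel _) s₀ hker
  refine ⟨t', fun a u => ?_⟩
  have := h.projective a
  rw [← Projective.factorThru_comp u (biproduct.desc f), ← hs₀, H.map_comp, Category.assoc, ht']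

end Descent

/-! ### The finite coend of `P a ⊠ M a` as a right exact functor -/

section CoverCoend

attribute [local instance] Abelian.hasFiniteBiproducts

variable (k : Type w) [Field k]
  {C : Type u₁} [Category.{v} C] [Abelian C] [Linear k C] [∀ X Y : C, Module.Finite k (X ⟶ Y)]
  {D : Type u₂} [Category.{v} D] [Abelian D] [Linear k D]
  {n : ℕ} {P : Fin n → C} (box : C ⥤ C ⥤ D)

/-- A functor on the category induced by a family of objects is linear. -/
structure CoverMod.IsLinear (M : CoverMod P) : Prop where
  act_add : ∀ {a b : Fin n} (r s : P a ⟶ P b), M.act (r + s) = M.act r + M.act s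
  act_smul : ∀ {a b : Fin n} (c : k) (r : P a ⟶ P b), M.act (c • r) = c • M.act r

theorem isLinear_coverBoxObj (X Y : C) : CoverMod.IsLinear k (coverBoxObj k P X Y) where
  act_add r s := coverBoxObj.hom_ext_val fun u => by simp
  act_smul c r := coverBoxObj.hom_ext_val fun u => by simp

/-- The relations defining the coend of `P a ⊠ M a`. -/
noncomputable def coverCoendRel (M : CoverMod P) :
    (⨁ fun x : Σ (a : Fin n) (b : Fin n), Fin (Module.finrank k (P a ⟶ P b)) =>
      (box.obj (P x.1)).obj (M.val x.2.1)) ⟶ ⨁ fun a => (box.obj (P a)).obj (M.val a) :=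
  biproduct.desc fun x =>
    (box.obj (P x.1)).map (M.act (Module.finBasis k _ x.2.2)) ≫
      biproduct.ι (fun a => (box.obj (P a)).obj (M.val a)) x.1 -
    (box.map (Module.finBasis k _ x.2.2)).app (M.val x.2.1) ≫
      biproduct.ι (fun a => (box.obj (P a)).obj (M.val a)) x.2.1

/-- The coend of `P a ⊠ M a`. -/
noncomputable def coverCoendObj (M : CoverMod P) : D := cokernel (coverCoendRel k box M)

namespace coverCoendObj

/-- The coprojections of the coend of `P a ⊠ M a`. -/
noncomputable def ins (M : CoverMod P) (a : Fin n) :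
    (box.obj (P a)).obj (M.val a) ⟶ coverCoendObj k box M :=
  biproduct.ι (fun a => (box.obj (P a)).obj (M.val a)) a ≫ cokernel.π (coverCoendRel k box M)

variable {k box}

omit [Linear k D] in
theorem hom_ext {M : CoverMod P} {T : D} {f g : coverCoendObj k box M ⟶ T}
    (h : ∀ a, ins k box M a ≫ f = ins k box M a ≫ g) : f = g := by
  refine (cancel_epi (cokernel.π (coverCoendRel k box M))).1 (biproduct.hom_ext' _ _ fun a => ?_)
  exact (Category.assoc _ _ _).symm.trans ((h a).trans (Category.assoc _ _ _))

omit [Linear k D] in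
theorem condition_basis (M : CoverMod P) (a b : Fin n)
    (i : Fin (Module.finrank k (P a ⟶ P b))) :
    (box.obj (P a)).map (M.act (Module.finBasis k (P a ⟶ P b) i)) ≫ ins k box M a =
      (box.map (Module.finBasis k (P a ⟶ P b) i)).app (M.val b) ≫ ins k box M b := by
  have := biproduct.ι (fun x : Σ (a : Fin n) (b : Fin n), Fin (Module.finrank k (P a ⟶ P b)) =>
    (box.obj (P x.1)).obj (M.val x.2.1)) ⟨a, b, i⟩ ≫= cokernel.condition (coverCoendRel k box M)
  rw [coverCoendRel, biproduct.ι_desc_assoc, comp_zero, Preadditive.sub_comp, sub_eq_zero,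
    Category.assoc, Category.assoc] at this
  exact this

/-- Morphisms out of the coend of `P a ⊠ M a`. -/
noncomputable def desc {M : CoverMod P} {T : D} (t : ∀ a, (box.obj (P a)).obj (M.val a) ⟶ T)
    (ht : ∀ (a b : Fin n) (i : Fin (Module.finrank k (P a ⟶ P b))),
      (box.obj (P a)).map (M.act (Module.finBasis k (P a ⟶ P b) i)) ≫ t a =
        (box.map (Module.finBasis k (P a ⟶ P b) i)).app (M.val b) ≫ t b) :
    coverCoendObj k box M ⟶ T :=
  cokernel.desc _ (biproduct.desc t) (biproduct.hom_ext' _ _ fun x => by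
    rw [coverCoendRel, biproduct.ι_desc_assoc, comp_zero, Preadditive.sub_comp, sub_eq_zero,
      Category.assoc, Category.assoc, biproduct.ι_desc, biproduct.ι_desc]
    exact ht _ _ _)

omit [Linear k D] in
@[simp]
theorem ins_desc {M : CoverMod P} {T : D} (t : ∀ a, (box.obj (P a)).obj (M.val a) ⟶ T)
    (ht : ∀ (a b : Fin n) (i : Fin (Module.finrank k (P a ⟶ P b))),
      (box.obj (P a)).map (M.act (Module.finBasis k (P a ⟶ P b) i)) ≫ t a =
        (box.map (Module.finBasis k (P a ⟶ P b) i)).app (M.val b) ≫ t b) (a : Fin n) :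
    ins k box M a ≫ desc t ht = t a :=
  (Category.assoc _ _ _).trans
    ((_ ≫= cokernel.π_desc _ _ _).trans (biproduct.ι_desc t a))

end coverCoendObj

/-- The functoriality of the coend of `P a ⊠ M a`. -/
noncomputable def coverCoendMap {M N : CoverMod P} (f : M ⟶ N) :
    coverCoendObj k box M ⟶ coverCoendObj k box N :=
  coverCoendObj.desc
    (fun a => (box.obj (P a)).map (CoverMod.comp f a) ≫ coverCoendObj.ins k box N a)
    (fun a b i => by
      rw [← Functor.map_comp_assoc, ← CoverMod.comp_act, Functor.map_comp, Category.assoc,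
        coverCoendObj.condition_basis, NatTrans.naturality_assoc])

omit [Linear k D] in
@[simp]
theorem coverCoendObj.ins_map {M N : CoverMod P} (f : M ⟶ N) (a : Fin n) :
    ins k box M a ≫ coverCoendMap k box f =
      (box.obj (P a)).map (CoverMod.comp f a) ≫ ins k box N a :=
  coverCoendObj.ins_desc _ _ a

omit [Linear k D] in
@[simp]
theorem coverCoendObj.ins_map_assoc {M N : CoverMod P} (f : M ⟶ N) (a : Fin n) {T : D}
    (t : coverCoendObj k box N ⟶ T) :
    ins k box M a ≫ coverCoendMap k box f ≫ t =
      (box.obj (P a)).map (CoverMod.comp f a) ≫ ins k box N a ≫ t := by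
  rw [← Category.assoc, ins_map, Category.assoc]

variable (P) in
/-- The coend of `P a ⊠ M a`, as a functor of `M`. -/
noncomputable def coverCoend : CoverMod P ⥤ D where
  obj M := coverCoendObj k box M
  map f := coverCoendMap k box f
  map_id M := coverCoendObj.hom_ext fun a => by simp
  map_comp f g := coverCoendObj.hom_ext fun a => by simp

variable {k box} (hbox : IsBirex k box)
include hbox

/-- Only the relations for basis morphisms are imposed in the cokernel. When `M` is linear both
sides are linear in `r`, so the relation holds for all `r`. -/
theorem coverCoendObj.condition {M : CoverMod P} (hM : M.IsLinear k) {a b : Fin n}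
    (r : P a ⟶ P b) :
    (box.obj (P a)).map (M.act r) ≫ ins k box M a =
      (box.map r).app (M.val b) ≫ ins k box M b := by
  obtain ⟨_, _, _⟩ := hbox.right (P a)
  obtain ⟨_, _, _⟩ := hbox.left (M.val b)
  let φ : (P a ⟶ P b) →ₗ[k] ((box.obj (P a)).obj (M.val b) ⟶ coverCoendObj k box M) :=
    { toFun := fun r => (box.obj (P a)).map (M.act r) ≫ ins k box M a
      map_add' := fun r s => by simp [hM.act_add, Functor.map_add]
      map_smul' := fun c r => by simp [hM.act_smul, Functor.map_smul] }
  let ψ : (P a ⟶ P b) →ₗ[k] ((box.obj (P a)).obj (M.val b) ⟶ coverCoendObj k box M) :=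
    { toFun := fun r => (box.flip.obj (M.val b)).map r ≫ ins k box M b
      map_add' := fun r s => by rw [Functor.map_add, Preadditive.add_comp]
      map_smul' := fun c r => by rw [Functor.map_smul, Linear.smul_comp]; rfl }
  exact LinearMap.congr_fun ((Module.finBasis k (P a ⟶ P b)).ext (f₁ := φ) (f₂ := ψ)
    fun i => coverCoendObj.condition_basis M a b i) r

theorem epi_coverCoendMap {M N : CoverMod P} (f : M ⟶ N) [Epi f] :
    Epi (coverCoendMap k box f) := by
  have hr := fun X => (hbox.right X).additive
  have he := fun X => (hbox.right X).rightExact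
  refine ⟨fun s t hst => coverCoendObj.hom_ext fun a => ?_⟩
  have := coverCoendObj.ins k box M a ≫= hst
  rw [coverCoendObj.ins_map_assoc, coverCoendObj.ins_map_assoc] at this
  exact (cancel_epi _).1 this

theorem exists_coverCoendMap_comp {S : ShortComplex (CoverMod P)} (hS : S.ShortExact)
    {T : D} (t : coverCoendObj k box S.X₂ ⟶ T) (ht : coverCoendMap k box S.f ≫ t = 0) :
    ∃ t', coverCoendMap k box S.g ≫ t' = t := by
  have hr := fun X => (hbox.right X).additive
  have he := fun X => (hbox.right X).rightExact
  have hga := hS.epi_g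
  have hex : ∀ a, ∃ t' : (box.obj (P a)).obj (S.X₃.val a) ⟶ T,
      (box.obj (P a)).map (CoverMod.comp S.g a) ≫ t' = coverCoendObj.ins k box S.X₂ a ≫ t := by
    intro a
    have hSa : (S.map ((evaluation _ C).obj (Opposite.op (CoverIdx.of a)))).ShortExact :=
      hS.map_of_exact _
    refine exists_desc_of_rightExact (box.obj (P a)) (CoverMod.comp S.f a)
      (CoverMod.comp S.g a) _ hSa.exact _ ?_
    rw [← coverCoendObj.ins_map_assoc, ht, comp_zero]
  choose t' ht' using hex
  refine ⟨coverCoendObj.desc t' fun a b i => ?_, coverCoendObj.hom_ext fun a => ?_⟩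
  -- The descended family is compatible because it becomes so after precomposition with the
  -- epimorphism `P a ⊠ S.g b`, where the relations for `S.X₂` apply.
  · rw [← cancel_epi ((box.obj (P a)).map (CoverMod.comp S.g b)), ← Functor.map_comp_assoc,
      CoverMod.comp_act, Functor.map_comp, Category.assoc, ht',
      reassoc_of% @coverCoendObj.condition_basis, NatTrans.naturality_assoc, ht']
  · rw [coverCoendObj.ins_map_assoc, coverCoendObj.ins_desc, ht']

theorem coverCoendMap_add {M N : CoverMod P} (f g : M ⟶ N) :
    coverCoendMap k box (f + g) = coverCoendMap k box f + coverCoendMap k box g := by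
  have hr := fun X => (hbox.right X).additive
  exact coverCoendObj.hom_ext fun a => by simp [Functor.map_add]

theorem coverCoendMap_smul {M N : CoverMod P} (c : k) (f : M ⟶ N) :
    coverCoendMap k box (c • f) = c • coverCoendMap k box f := by
  have hl := fun X => (hbox.right X).linear
  exact coverCoendObj.hom_ext fun a => by simp [Functor.map_smul]

theorem isRex_coverCoend : IsRex k (coverCoend k P box) := by
  have hadd : (coverCoend k P box).Additive := ⟨coverCoendMap_add hbox _ _⟩
  refine ⟨hadd, ⟨fun f c => coverCoendMap_smul hbox c f⟩, ?_⟩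
  refine preservesFiniteColimits_of_shortExact _ (fun S hS => ?_)
    (fun S hS T t ht => exists_coverCoendMap_comp hbox hS t ht)
  have := hS.epi_g
  exact epi_coverCoendMap hbox S.g

end CoverCoend

/-! ### Co-Yoneda: the coend functor recovers `X ⊠ Y` -/

section CoverCoendBox

variable {k : Type w} [Field k]
  {C : Type u₁} [Category.{v} C] [Abelian C] [Linear k C] [∀ X Y : C, Module.Finite k (X ⟶ Y)]
  {D : Type u₂} [Category.{v} D] [Abelian D] [Linear k D]
  {n : ℕ} {V P : Fin n → C} {π : ∀ i, P i ⟶ V i}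
  {box : C ⥤ C ⥤ D}

omit [Linear k D] in
theorem coverBoxObj.map_hom_ext_val {H : C ⥤ D} [H.Additive] {X Y : C} {T : D} {a : Fin n}
    {f g : H.obj ((coverBoxObj k P X Y).val a) ⟶ T}
    (h : ∀ u : P a ⟶ X, H.map (ins P Y u) ≫ f = H.map (ins P Y u) ≫ g) : f = g :=
  copow.map_hom_ext k H h

/-- Morphisms out of the image of a value of the functor `a ↦ Hom(P a, X) ⊗ Y`. -/
noncomputable def coverBoxObj.mapDescVal (H : C ⥤ D) [H.Linear k] {X Y : C} {T : D}
    {a : Fin n} (φ : (P a ⟶ X) →ₗ[k] (H.obj Y ⟶ T)) :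
    H.obj ((coverBoxObj k P X Y).val a) ⟶ T :=
  copow.mapDesc k H φ

@[simp]
theorem coverBoxObj.map_ins_mapDescVal (H : C ⥤ D) [H.Linear k] {X Y : C} {T : D}
    {a : Fin n} (φ : (P a ⟶ X) →ₗ[k] (H.obj Y ⟶ T)) (u : P a ⟶ X) :
    H.map (ins P Y u) ≫ mapDescVal H φ = φ u :=
  copow.map_ins_mapDesc k H φ u

variable (hbox : IsBirex k box)

/-- The canonical morphism from the coend of `P a ⊠ (Hom(P a, X) ⊗ Y)` to `X ⊠ Y`. -/
noncomputable def coverCoendBoxHom (X Y : C) :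
    coverCoendObj k box (coverBoxObj k P X Y) ⟶ (box.obj X).obj Y :=
  have := fun X => (hbox.right X).additive
  have := fun X => (hbox.right X).linear
  have := fun Y => (hbox.left Y).additive
  have := fun Y => (hbox.left Y).linear
  coverCoendObj.desc (fun a => coverBoxObj.mapDescVal (box.obj (P a))
    ((box.flip.obj Y).mapLinearMap k)) (fun a b i => by
      refine coverBoxObj.map_hom_ext_val fun u => ?_
      rw [← Functor.map_comp_assoc, coverBoxObj.ins_act, NatTrans.naturality_assoc,
        coverBoxObj.map_ins_mapDescVal, coverBoxObj.map_ins_mapDescVal]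
      exact (box.flip.obj Y).map_comp _ _)

@[simp]
theorem map_ins_ins_coverCoendBoxHom (X Y : C) (a : Fin n) (u : P a ⟶ X) :
    (box.obj (P a)).map (coverBoxObj.ins (k := k) P Y u) ≫
      coverCoendObj.ins k box (coverBoxObj k P X Y) a ≫ coverCoendBoxHom hbox X Y =
        (box.map u).app Y := by
  have := fun X => (hbox.right X).linear
  have := fun Y => (hbox.left Y).linear
  rw [coverCoendBoxHom, coverCoendObj.ins_desc]
  exact coverBoxObj.map_ins_mapDescVal (box.obj (P a)) _ u

include hbox in
theorem coverCoendBox_hom_ext {X Y : C} {T : D}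
    {f g : coverCoendObj k box (coverBoxObj k P X Y) ⟶ T}
    (h : ∀ a (u : P a ⟶ X), (box.obj (P a)).map (coverBoxObj.ins (k := k) P Y u) ≫
      coverCoendObj.ins k box (coverBoxObj k P X Y) a ≫ f =
        (box.obj (P a)).map (coverBoxObj.ins (k := k) P Y u) ≫
      coverCoendObj.ins k box (coverBoxObj k P X Y) a ≫ g) : f = g := by
  have := fun X => (hbox.right X).additive
  exact coverCoendObj.hom_ext fun a => coverBoxObj.map_hom_ext_val fun u => h a u

/-- The inverse comes from descent for `- ⊠ Y`: each `u : P a ⟶ X` gives a map from `P a ⊠ Y` to the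
coend via the element `u`, and the coend relations make these maps compatible. -/
theorem isIso_coverCoendBoxHom (h : IsCoverSystem π) (X Y : C) :
    IsIso (coverCoendBoxHom (P := P) hbox X Y) := by
  obtain ⟨_, _, _⟩ := hbox.left Y
  have := fun X => (hbox.right X).additive
  have hc := fun {a b : Fin n} (r : P a ⟶ P b) =>
    coverCoendObj.condition hbox (isLinear_coverBoxObj (P := P) k X Y) r
  obtain ⟨t', ht'⟩ := h.exists_descent k (box.flip.obj Y) (X := X)
    (T := coverCoendObj k box (coverBoxObj k P X Y))
    (fun a u => (box.obj (P a)).map (coverBoxObj.ins (k := k) P Y u) ≫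
      coverCoendObj.ins k box (coverBoxObj k P X Y) a)
    (fun a f g => by rw [map_add, Functor.map_add, Preadditive.add_comp])
    (fun a b r f => by
      have h1 := hc r
      rw [← coverBoxObj.ins_act, Functor.map_comp, Category.assoc, h1,
        NatTrans.naturality_assoc]
      rfl)
  refine ⟨t', coverCoendBox_hom_ext hbox fun a u => ?_, h.map_hom_ext k (box.flip.obj Y)
    fun a u => ?_⟩
  · rw [reassoc_of% @map_ins_ins_coverCoendBoxHom, Category.comp_id]
    exact ht' a u
  · rw [← Category.assoc, ht', Category.assoc, map_ins_ins_coverCoendBoxHom]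
    exact (Category.comp_id _).symm

theorem coverCoendBoxHom_naturality_right (X : C) {Y Y' : C} (g : Y ⟶ Y') :
    coverCoendMap k box (coverBoxMap (P := P) k (𝟙 X) g) ≫ coverCoendBoxHom hbox X Y' =
      coverCoendBoxHom hbox X Y ≫ (box.obj X).map g := by
  refine coverCoendBox_hom_ext hbox fun a u => ?_
  rw [coverCoendObj.ins_map_assoc, ← Functor.map_comp_assoc, coverBoxObj.ins_map,
    Functor.map_comp_assoc, Category.comp_id, map_ins_ins_coverCoendBoxHom,
    reassoc_of% @map_ins_ins_coverCoendBoxHom, NatTrans.naturality]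

theorem coverCoendBoxHom_naturality_left {X X' : C} (f : X ⟶ X') (Y : C) :
    coverCoendMap k box (coverBoxMap (P := P) k f (𝟙 Y)) ≫ coverCoendBoxHom hbox X' Y =
      coverCoendBoxHom hbox X Y ≫ (box.map f).app Y := by
  refine coverCoendBox_hom_ext hbox fun a u => ?_
  rw [coverCoendObj.ins_map_assoc, ← Functor.map_comp_assoc, coverBoxObj.ins_map,
    Category.id_comp, map_ins_ins_coverCoendBoxHom, reassoc_of% @map_ins_ins_coverCoendBoxHom,
    Functor.map_comp, NatTrans.comp_app]

/-- The coend of `P a ⊠ (Hom(P a, X) ⊗ Y)` is naturally isomorphic to `X ⊠ Y`. -/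
noncomputable def coverCoendBoxIso (h : IsCoverSystem π) :
    coverBox k P ⋙ (Functor.whiskeringRight C _ D).obj (coverCoend k P box) ≅ box :=
  NatIso.ofComponents (fun X => NatIso.ofComponents
      (fun Y => @asIso _ _ _ _ (coverCoendBoxHom (P := P) hbox X Y)
        (isIso_coverCoendBoxHom hbox h X Y))
      (fun g => coverCoendBoxHom_naturality_right hbox X g))
    (fun f => by
      ext Y
      exact coverCoendBoxHom_naturality_left hbox f Y)

/-- `G ⋙ coverCoend k P box` is right exact and restricts to `box`, so it is isomorphic to the
identity of `D`. -/
theorem IsDeligneProduct.faithful_of_iso_coverBox (hbox : IsDeligneProduct k box)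
    (h : IsCoverSystem π) (G : D ⥤ CoverMod P) (hG : IsRex k G)
    (e : (precomp box _).obj G ≅ coverBox k P) : G.Faithful := by
  obtain ⟨i⟩ := hbox.nonempty_iso_id (G ⋙ coverCoend k P box)
    (hG.comp (isRex_coverCoend hbox.birex))
    (Functor.isoWhiskerRight e ((Functor.whiskeringRight C _ D).obj (coverCoend k P box)) ≪≫
      coverCoendBoxIso hbox.birex h)
  exact Functor.Faithful.of_comp_iso i

/-- The morphism `Hom(P a, P b) ⊗ M b ⟶ M a` given by the action. -/
noncomputable def CoverMod.IsLinear.actVal {M : CoverMod P} (hM : M.IsLinear k) (a b : Fin n) :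
    (coverBoxObj k P (P b) (M.val b)).val a ⟶ M.val a :=
  coverBoxObj.descVal
    { toFun := fun r => M.act r
      map_add' := fun r s => hM.act_add r s
      map_smul' := fun c r => hM.act_smul c r }

@[simp]
theorem CoverMod.IsLinear.ins_actVal {M : CoverMod P} (hM : M.IsLinear k) (a b : Fin n)
    (r : P a ⟶ P b) : coverBoxObj.ins P (M.val b) r ≫ hM.actVal a b = M.act r :=
  coverBoxObj.ins_descVal _ r

/-! ### The counit, and preservation of monomorphisms by the coend functor -/

section Values

variable (H : D ⥤ C) [H.Additive] [PreservesFiniteColimits H] {l : Fin n}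
  (β : ∀ X Y, H.obj ((box.obj X).obj Y) ≅ (coverBoxObj k P X Y).val l)
  (hr : ∀ X {Y Y'} (g : Y ⟶ Y'), H.map ((box.obj X).map g) ≫ (β X Y').hom =
    (β X Y).hom ≫ CoverMod.comp (coverBoxMap k (𝟙 X) g) l)
  (hl : ∀ {X X'} (f : X ⟶ X') Y, H.map ((box.map f).app Y) ≫ (β X' Y).hom =
    (β X Y).hom ≫ CoverMod.comp (coverBoxMap k f (𝟙 Y)) l)

attribute [local instance] Abelian.hasFiniteBiproducts

omit [PreservesFiniteColimits H] in
theorem map_biproduct_hom_ext {σ : Type} [Fintype σ] {Z : σ → D} {T : C}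
    {f g : H.obj (⨁ Z) ⟶ T}
    (h : ∀ s, H.map (biproduct.ι Z s) ≫ f = H.map (biproduct.ι Z s) ≫ g) : f = g := by
  rw [← Category.id_comp f, ← Category.id_comp g, ← H.map_id, ← biproduct.total, H.map_sum,
    Preadditive.sum_comp, Preadditive.sum_comp]
  refine Finset.sum_congr rfl fun s _ => ?_
  rw [H.map_comp, Category.assoc, Category.assoc, h]

omit [Linear k D] in
theorem coverCoendObj.map_hom_ext {M : CoverMod P} {T : C}
    {f g : H.obj (coverCoendObj k box M) ⟶ T}
    (h : ∀ a, H.map (ins k box M a) ≫ f = H.map (ins k box M a) ≫ g) : f = g := by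
  have he : Epi (H.map (cokernel.π (coverCoendRel k box M))) := inferInstance
  refine he.left_cancellation _ _ (map_biproduct_hom_ext H fun a => ?_)
  have hins : H.map (ins k box M a) = H.map (biproduct.ι (fun a => (box.obj (P a)).obj (M.val a)) a)
      ≫ H.map (cokernel.π (coverCoendRel k box M)) := H.map_comp _ _
  exact (Category.assoc _ _ _).symm.trans
    ((hins =≫ f).symm.trans ((h a).trans ((hins =≫ g).trans (Category.assoc _ _ _))))

omit [Linear k D] in
theorem coverCoendObj.exists_map_desc {M : CoverMod P} {T : C}
    (t : ∀ a, H.obj ((box.obj (P a)).obj (M.val a)) ⟶ T)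
    (ht : ∀ (a b : Fin n) (r : P a ⟶ P b),
      H.map ((box.obj (P a)).map (M.act r)) ≫ t a = H.map ((box.map r).app (M.val b)) ≫ t b) :
    ∃ t' : H.obj (coverCoendObj k box M) ⟶ T, ∀ a, H.map (ins k box M a) ≫ t' = t a := by
  let s : H.obj (⨁ fun a => (box.obj (P a)).obj (M.val a)) ⟶ T :=
    ∑ a, H.map (biproduct.π (fun a => (box.obj (P a)).obj (M.val a)) a) ≫ t a
  have hs : ∀ a, H.map (biproduct.ι (fun a => (box.obj (P a)).obj (M.val a)) a) ≫ s = t a := by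
    intro a
    rw [Preadditive.comp_sum, Finset.sum_eq_single a]
    · rw [← H.map_comp_assoc, biproduct.ι_π_self, H.map_id, Category.id_comp]
    · intro b _ hb
      rw [← H.map_comp_assoc, biproduct.ι_π_ne _ hb.symm, H.map_zero, zero_comp]
    · simp
  obtain ⟨t', ht'⟩ := exists_desc_of_rightExact H (coverCoendRel k box M)
    (cokernel.π (coverCoendRel k box M)) (cokernel.condition _) (ShortComplex.exact_cokernel _) s
    (map_biproduct_hom_ext H fun x => by
      rw [← H.map_comp_assoc, coverCoendRel, biproduct.ι_desc, H.map_sub, H.map_comp, H.map_comp,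
        Preadditive.sub_comp, Category.assoc, Category.assoc, hs, hs, ht, sub_self, comp_zero])
  refine ⟨t', fun a => ?_⟩
  have hins : H.map (ins k box M a) = H.map (biproduct.ι (fun a => (box.obj (P a)).obj (M.val a)) a)
      ≫ H.map (cokernel.π (coverCoendRel k box M)) := H.map_comp _ _
  exact (hins =≫ t').trans ((Category.assoc _ _ _).trans ((_ ≫= ht').trans (hs a)))

include hr hl

-- `H` stands for evaluation at `l` of the factorization of `coverBox` through `D`. It turns `P a ⊠
-- M a` into Hom(`P l`, `P a`) ⊗ `M a`, which acts into `M l`; functoriality of the action is the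
-- coend relation.
omit [Linear k D] in
theorem exists_counit {M : CoverMod P} (hM : M.IsLinear k) :
    ∃ κ : H.obj (coverCoendObj k box M) ⟶ M.val l,
      ∀ a, H.map (coverCoendObj.ins k box M a) ≫ κ =
        (β (P a) (M.val a)).hom ≫ hM.actVal l a := by
  refine coverCoendObj.exists_map_desc H _ fun a b r => ?_
  rw [reassoc_of% (hr (P a) (M.act r)), reassoc_of% (hl r (M.val b))]
  congr 1
  refine coverBoxObj.hom_ext_val fun u => ?_
  rw [coverBoxObj.ins_map_assoc, coverBoxObj.ins_map_assoc, Category.comp_id, Category.id_comp,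
    hM.ins_actVal, hM.ins_actVal, CoverMod.act_comp]

/-- `κ` has a retraction: `M l` maps to the summand Hom(`P l`, `P l`) ⊗ `M l` through the identity,
and from there to the coend. -/
theorem mono_counit (hbox : IsBirex k box) {M : CoverMod P} (hM : M.IsLinear k)
    (κ : H.obj (coverCoendObj k box M) ⟶ M.val l)
    (hκ : ∀ a, H.map (coverCoendObj.ins k box M a) ≫ κ =
      (β (P a) (M.val a)).hom ≫ hM.actVal l a) : Mono κ := by
  let σ : M.val l ⟶ H.obj (coverCoendObj k box M) :=
    coverBoxObj.ins P (M.val l) (𝟙 (P l)) ≫ (β (P l) (M.val l)).inv ≫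
      H.map (coverCoendObj.ins k box M l)
  have hr' : ∀ X {Y Y'} (g : Y ⟶ Y'), CoverMod.comp (coverBoxMap k (𝟙 X) g) l ≫ (β X Y').inv =
      (β X Y).inv ≫ H.map ((box.obj X).map g) := fun X Y Y' g => by
    rw [Iso.eq_inv_comp, ← reassoc_of% (hr X g), Iso.hom_inv_id, Category.comp_id]
  have hl' : ∀ {X X'} (f : X ⟶ X') Y, CoverMod.comp (coverBoxMap k f (𝟙 Y)) l ≫ (β X' Y).inv =
      (β X Y).inv ≫ H.map ((box.map f).app Y) := fun {X X'} f Y => by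
    rw [Iso.eq_inv_comp, ← reassoc_of% (hl f Y), Iso.hom_inv_id, Category.comp_id]
  -- The coend relation for `u : P l ⟶ P a` identifies `u ⊗ m` with `𝟙 ⊗ M.act u (m)`, which is what
  -- `κ ≫ σ` produces.
  have hσ : κ ≫ σ = 𝟙 _ := by
    refine coverCoendObj.map_hom_ext H fun a => ?_
    rw [← cancel_epi (β (P a) (M.val a)).inv, reassoc_of% (hκ a), Iso.inv_hom_id_assoc,
      Category.comp_id]
    refine coverBoxObj.hom_ext_val fun u => ?_
    have h1 : coverBoxObj.ins (k := k) P (M.val a) u =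
        coverBoxObj.ins P (M.val a) (𝟙 (P l)) ≫ CoverMod.comp (coverBoxMap k u (𝟙 _)) l := by
      rw [coverBoxObj.ins_map, Category.id_comp, Category.id_comp]
    have h2 : M.act u ≫ coverBoxObj.ins (k := k) P (M.val l) (𝟙 (P l)) =
        coverBoxObj.ins P (M.val a) (𝟙 (P l)) ≫
          CoverMod.comp (coverBoxMap k (𝟙 (P l)) (M.act u)) l := by
      rw [coverBoxObj.ins_map, Category.comp_id]
    rw [← Category.assoc, hM.ins_actVal, reassoc_of% h2, reassoc_of% (hr' (P l) (M.act u)),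
      ← H.map_comp, coverCoendObj.condition hbox hM, H.map_comp,
      ← reassoc_of% (hl' u (M.val a)), reassoc_of% h1]
  exact (SplitMono.mk σ hσ).mono

/-- By naturality of the counit, the image of `f` followed by `κN` equals the monomorphism `κM`
followed by the component of `f` at `l`. -/
theorem mono_map_coverCoendMap (hbox : IsBirex k box) {M N : CoverMod P} (hM : M.IsLinear k)
    (hN : N.IsLinear k) (f : M ⟶ N) [Mono f] : Mono (H.map (coverCoendMap k box f)) := by
  obtain ⟨κM, hκM⟩ := exists_counit H β hr hl hM
  obtain ⟨κN, hκN⟩ := exists_counit H β hr hl hN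
  have := mono_counit H β hr hl hbox hM κM hκM
  have hnat : H.map (coverCoendMap k box f) ≫ κN = κM ≫ CoverMod.comp f l := by
    refine coverCoendObj.map_hom_ext H fun a => ?_
    rw [← H.map_comp_assoc, coverCoendObj.ins_map, H.map_comp_assoc, hκN,
      reassoc_of% (hκM a), reassoc_of% (hr (P a) (CoverMod.comp f a))]
    congr 1
    refine coverBoxObj.hom_ext_val fun u => ?_
    rw [coverBoxObj.ins_map_assoc, Category.comp_id, hN.ins_actVal, ← Category.assoc,
      hM.ins_actVal, CoverMod.comp_act]
  have hm : Mono (H.map (coverCoendMap k box f) ≫ κN) := by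
    rw [hnat]
    infer_instance
  exact mono_of_mono _ κN

end Values

/-- The image under the faithful functor `G` is mono at every index, and a faithful additive functor
reflects monomorphisms. -/
theorem IsDeligneProduct.mono_coverCoendMap [IsFiniteAbelian k C] (hbox : IsDeligneProduct k box)
    (h : IsCoverSystem π) {M N : CoverMod P} (hM : M.IsLinear k)
    (hN : N.IsLinear k) (f : M ⟶ N) [Mono f] : Mono (coverCoendMap k box f) := by
  have := h.projective
  obtain ⟨G, hG, ⟨e⟩⟩ := hbox.exists_factorization_coverMod P (coverBox k P) isBirex_coverBox
  have := hbox.faithful_of_iso_coverBox h G hG e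
  obtain ⟨_, _, _⟩ := hG
  have hmono : Mono (G.map (coverCoendMap k box f)) := by
    rw [NatTrans.mono_iff_mono_app]
    intro a
    have : (G ⋙ (evaluation _ C).obj a).Additive := inferInstance
    exact mono_map_coverCoendMap (G ⋙ (evaluation _ C).obj a) (l := a.unop.idx)
      (fun X Y => (((e.app X).app Y).app a))
      (fun X Y Y' g => congrArg (fun φ => φ.app a) ((e.hom.app X).naturality g))
      (fun {X X'} g Y => congrArg (fun φ => (φ.app Y).app a) (e.hom.naturality g))
      hbox.birex hM hN f
  refine Preadditive.mono_of_cancel_zero _ fun g hg => ?_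
  apply G.map_injective
  rw [← cancel_mono (G.map (coverCoendMap k box f)), ← G.map_comp, hg, G.map_zero, G.map_zero,
    zero_comp]

end CoverCoendBox

/-! ### Additivity in the Grothendieck group -/

section GrothendieckGroup

variable {D : Type u} [Category.{v} D] [Abelian D]

theorem grClass_of_shortExact {S : ShortComplex D} (hS : S.ShortExact) :
    grClass S.X₂ = grClass S.X₁ + grClass S.X₃ := by
  have : (QuotientAddGroup.mk (FreeAbelianGroup.of S.X₂ - FreeAbelianGroup.of S.X₁ -
      FreeAbelianGroup.of S.X₃) : Gr D) = 0 :=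
    (QuotientAddGroup.eq_zero_iff _).2 (AddSubgroup.subset_closure ⟨S, hS, rfl⟩)
  have h : grClass S.X₂ - grClass S.X₁ - grClass S.X₃ = 0 := this
  rw [sub_sub, sub_eq_zero] at h
  exact h

theorem grClass_of_isZero {X : D} (hX : IsZero X) : grClass X = 0 := by
  have hS : (ShortComplex.mk (0 : X ⟶ X) (0 : X ⟶ X) zero_comp).ShortExact :=
    { exact := ShortComplex.exact_of_isZero_X₂ _ hX
      mono_f := ⟨fun a b _ => hX.eq_of_tgt a b⟩
      epi_g := ⟨fun a b _ => hX.eq_of_src a b⟩ }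
  simpa using grClass_of_shortExact hS

theorem grClass_eq_of_iso {X Y : D} (e : X ≅ Y) : grClass X = grClass Y := by
  have h := grClass_of_shortExact (shortExact_of_epi e.hom)
  have h0 : IsZero (kernel e.hom) := isZero_kernel_of_mono e.hom
  simpa [grClass_of_isZero h0] using h

end GrothendieckGroup

/-! ### Dévissage: the class of the finite coend -/

section Devissage

variable {k : Type w} [Field k]
  {C : Type u₁} [Category.{v} C] [Abelian C] [Linear k C] [∀ X Y : C, Module.Finite k (X ⟶ Y)]
  {D : Type u₂} [Category.{v} D] [Abelian D] [Linear k D]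
  {n : ℕ} {V P : Fin n → C} {π : ∀ i, P i ⟶ V i}
  {box : C ⥤ C ⥤ D}

-- Induction on the length of `Z`: for a simple quotient of `Z`, either `φ` is nonzero on the image
-- of the kernel, or by right exactness it descends to a nonzero map on the image of the quotient.
variable (k) in
theorem IsCoverSystem.exists_simple_hom_ne_zero (h : IsCoverSystem π)
    {E : Type u} [Category.{v} E] [Abelian E] (F : C ⥤ E) [F.Additive] [PreservesFiniteColimits F]
    {M : E} (d : ℕ) : ∀ (Z : C) (_ : ∑ i, Module.finrank k (P i ⟶ Z) = d) (φ : F.obj Z ⟶ M),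
      φ ≠ 0 → ∃ (i : Fin n) (φ' : F.obj (V i) ⟶ M), φ' ≠ 0 := by
  induction d using Nat.strong_induction_on with
  | _ d ih =>
  intro Z hZ φ hφ
  have hz : ¬ IsZero Z := fun h0 => hφ ((F.map_isZero h0).eq_of_src _ _)
  obtain ⟨S, q, hS, hq⟩ := h.exists_simple_quotient Z hz
  by_cases h1 : F.map (kernel.ι q) ≫ φ = 0
  · obtain ⟨φ', hφ'⟩ := exists_desc_of_rightExact F (kernel.ι q) q (kernel.condition q)
      (ShortComplex.exact_kernel q) φ h1
    obtain ⟨i, ⟨e⟩⟩ := h.complete S hS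
    refine ⟨i, F.map e.inv ≫ φ', fun h2 => hφ ?_⟩
    have h3 : φ' = 0 := by rw [← cancel_epi (F.map e.inv), h2, comp_zero]
    rw [← hφ', h3, comp_zero]
  · refine ih _ ?_ (kernel q) rfl _ h1
    have hsum : ∑ i, Module.finrank k (P i ⟶ Z) =
        ∑ i, Module.finrank k (P i ⟶ kernel q) + ∑ i, Module.finrank k (P i ⟶ S) := by
      rw [← Finset.sum_add_distrib]
      refine Finset.sum_congr rfl fun i _ => ?_
      have := h.projective i
      exact finrank_hom_of_shortExact k (P i) (shortExact_of_epi q)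
    have hpos : ∑ i, Module.finrank k (P i ⟶ S) ≠ 0 := by
      intro h0
      apply Simple.not_isZero S
      rw [h.isZero_iff k]
      intro i
      exact Finset.sum_eq_zero_iff.1 h0 i (Finset.mem_univ i)
    omega

omit [Linear k C] [∀ X Y : C, Module.Finite k (X ⟶ Y)] in
theorem copow.simple (U : Type u) [AddCommGroup U] [Module k U] (hU : Module.finrank k U = 1)
    (Y : C) [Simple Y] : Simple (copow k U Y) := by
  let s₀ : Fin (Module.finrank k U) := ⟨0, by omega⟩
  have hs : ∀ s, s = s₀ := fun s => by ext; simp [s₀]; omega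
  let e : copow k U Y ≅ Y :=
    { hom := copow.π k U Y s₀
      inv := copow.ι k U Y s₀
      hom_inv_id := by
        rw [← copow.total, Finset.sum_eq_single s₀]
        · exact fun b _ hb => absurd (hs b) hb
        · simp
      inv_hom_id := by rw [copow.ι_π, if_pos rfl] }
  exact Simple.of_iso e

/-- The functor attached to `(V i, V j)` vanishes away from index `i` and takes a simple value at
`i`. -/
theorem mono_of_coverBoxObj_ne_zero [IsAlgClosed k] (h : IsCoverSystem π) {i j : Fin n}
    {M : CoverMod P} (φ : coverBoxObj k P (V i) (V j) ⟶ M) (hφ : φ ≠ 0) : Mono φ := by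
  have hz : ∀ a, i ≠ a → IsZero ((coverBoxObj k P (V i) (V j)).val a) := by
    intro a ha
    have h0 := h.finrank_hom_cover k a i
    rw [if_neg ha] at h0
    have := Module.finrank_zero_iff.1 h0
    rw [IsZero.iff_id_eq_zero]
    refine coverBoxObj.hom_ext_val fun u => ?_
    rw [Subsingleton.elim u 0, map_zero, zero_comp, zero_comp]
  have := h.simple j
  have hs : Simple ((coverBoxObj k P (V i) (V j)).val i) :=
    copow.simple (k := k) (P i ⟶ V i) (by rw [h.finrank_hom_cover k, if_pos rfl]) (V j)
  have hmono : ∀ a, Mono (CoverMod.comp φ a) := by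
    intro a
    by_cases ha : i = a
    · subst ha
      refine mono_of_nonzero_from_simple fun h0 => hφ (CoverMod.hom_ext fun b => ?_)
      by_cases hb : i = b
      · subst hb
        exact h0
      · exact (hz b hb).eq_of_src _ _
    · exact ⟨fun s t _ => (hz _ ha).eq_of_tgt s t⟩
  rw [NatTrans.mono_iff_mono_app]
  exact fun a => hmono a.unop.idx

/-- The action gives a map from the functor of `(P a, M a)` to `M`, nonzero since `𝟙 (P a)` acts as
the identity. Reducing first `P a` and then `M a` to simple objects keeps a nonzero map. -/
theorem CoverMod.IsLinear.exists_mono_coverBoxObj [IsAlgClosed k] (h : IsCoverSystem π)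
    {M : CoverMod P} (hM : M.IsLinear k) (a : Fin n) (ha : ¬ IsZero (M.val a)) :
    ∃ (i j : Fin n) (φ : coverBoxObj k P (V i) (V j) ⟶ M), Mono φ := by
  have := h.projective
  let φ₀ : coverBoxObj k P (P a) (M.val a) ⟶ M := coverBoxObj.desc
    (fun b => { toFun := fun r => M.act r
                map_add' := fun r s => hM.act_add r s
                map_smul' := fun c r => hM.act_smul c r })
    (fun r u => (M.act_comp r u).symm)
  have hφ₀ : φ₀ ≠ 0 := by
    intro h0
    apply ha
    rw [IsZero.iff_id_eq_zero, ← M.act_id]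
    have := coverBoxObj.ins_desc (k := k) (X := P a) (Y := M.val a) (M := M)
      (fun b => { toFun := fun r => M.act r
                  map_add' := fun r s => hM.act_add r s
                  map_smul' := fun c r => hM.act_smul c r })
      (fun r u => (M.act_comp r u).symm) a (𝟙 (P a))
    refine this.symm.trans ?_
    change _ ≫ CoverMod.comp φ₀ a = 0
    rw [h0]
    exact comp_zero
  obtain ⟨_, _, _⟩ := isRex_coverBox_flip_obj (k := k) (P := P) (M.val a)
  obtain ⟨i, φ₁, hφ₁⟩ := h.exists_simple_hom_ne_zero k ((coverBox k P).flip.obj (M.val a)) _ (P a)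
    rfl φ₀ hφ₀
  obtain ⟨_, _, _⟩ := isRex_coverBox_obj (k := k) (P := P) (V i)
  obtain ⟨j, φ₂, hφ₂⟩ := h.exists_simple_hom_ne_zero k ((coverBox k P).obj (V i)) _ (M.val a)
    rfl φ₁ hφ₁
  exact ⟨i, j, φ₂, mono_of_coverBoxObj_ne_zero h φ₂ hφ₂⟩

omit [∀ X Y : C, Module.Finite k (X ⟶ Y)] in
theorem CoverMod.IsLinear.of_epi {M N : CoverMod P} (hM : M.IsLinear k) (f : M ⟶ N) [Epi f] :
    N.IsLinear k where
  act_add {a b} r s := by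
    rw [← cancel_epi (CoverMod.comp f b), Preadditive.comp_add, CoverMod.comp_act,
      CoverMod.comp_act, CoverMod.comp_act, hM.act_add, Preadditive.add_comp]
  act_smul {a b} c r := by
    rw [← cancel_epi (CoverMod.comp f b), Linear.comp_smul, CoverMod.comp_act,
      CoverMod.comp_act, hM.act_smul, Linear.smul_comp]

/-- The class of the coend of `P a ⊠ M a`. -/
theorem IsDeligneProduct.grClass_coverCoendObj [IsAlgClosed k] [IsFiniteAbelian k C]
    (hbox : IsDeligneProduct k box) (h : IsCoverSystem π) (d : ℕ) : ∀ (M : CoverMod P),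
    M.IsLinear k → ∑ a, ∑ b, Module.finrank k (P b ⟶ M.val a) = d →
    grClass (coverCoendObj k box M) =
      ∑ a, ∑ b, Module.finrank k (P b ⟶ M.val a) • grClass ((box.obj (V a)).obj (V b)) := by
  induction d using Nat.strong_induction_on with
  | _ d ih =>
  intro M hM hd
  by_cases hz : ∀ a, IsZero (M.val a)
  · rw [grClass_of_isZero]
    · symm
      refine Finset.sum_eq_zero fun a _ => Finset.sum_eq_zero fun b _ => ?_
      rw [(h.isZero_iff k _).1 (hz a) b, zero_smul]
    · rw [IsZero.iff_id_eq_zero]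
      refine coverCoendObj.hom_ext fun a => ?_
      have := (hbox.birex.right (P a)).additive
      exact ((box.obj (P a)).map_isZero (hz a)).eq_of_src _ _
  push Not at hz
  obtain ⟨a₀, ha₀⟩ := hz
  obtain ⟨i, j, φ, hφ⟩ := hM.exists_mono_coverBoxObj h a₀ ha₀
  have hS := shortExact_of_mono φ
  have hM' : (cokernel φ).IsLinear k := hM.of_epi (cokernel.π φ)
  have hadd : ∀ a b, Module.finrank k (P b ⟶ M.val a) =
      Module.finrank k (P b ⟶ (coverBoxObj k P (V i) (V j)).val a) +
        Module.finrank k (P b ⟶ (cokernel φ).val a) := by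
    intro a b
    have := h.projective b
    have hSa := hS.map_of_exact ((evaluation _ C).obj (Opposite.op (CoverIdx.of a)))
    exact finrank_hom_of_shortExact k (P b) hSa
  have hbx : ∀ a b, Module.finrank k (P b ⟶ (coverBoxObj k P (V i) (V j)).val a) =
      if a = i ∧ b = j then 1 else 0 := by
    intro a b
    refine (copow.finrank_hom k (U := (P a ⟶ V i)) (P b) (V j)).trans ?_
    rw [h.finrank_hom_cover k, h.finrank_hom_cover k]
    rw [ite_and, ite_mul, one_mul, zero_mul]
    simp only [eq_comm (a := i), eq_comm (a := j)]
  -- Left exactness enters here: right exactness alone would leave a possible kernel of the map on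
  -- coends.
  have hΨ : (ShortComplex.mk (coverCoendMap k box φ) (coverCoendMap k box (cokernel.π φ))
      (by
        obtain ⟨_, _, _⟩ := isRex_coverCoend (P := P) hbox.birex
        have := (coverCoend k P box).map_comp φ (cokernel.π φ)
        rw [cokernel.condition, Functor.map_zero] at this
        exact this.symm)).ShortExact := by
    obtain ⟨_, _, hr⟩ := isRex_coverCoend (P := P) hbox.birex
    rw [((Functor.preservesFiniteColimits_tfae (coverCoend k P box)).out 3 0 :)] at hr
    exact { exact := (hr _ hS).1
            mono_f := hbox.mono_coverCoendMap h (isLinear_coverBoxObj k _ _) hM φ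
            epi_g := (hr _ hS).2 }
  have := isIso_coverCoendBoxHom hbox.birex h (V i) (V j)
  have hcls := grClass_of_shortExact hΨ
  -- The subfunctor contributes exactly 1 to the total dimension, so the cokernel falls under the
  -- induction hypothesis.
  have hsum1 : ∑ a, ∑ b, Module.finrank k (P b ⟶ (coverBoxObj k P (V i) (V j)).val a) = 1 := by
    rw [Finset.sum_eq_single i, Finset.sum_eq_single j]
    · simp [hbx]
    · intro b _ hb; simp [hbx, hb]
    · simp
    · intro a _ ha; simp [hbx, ha]
    · simp
  have hlt : ∑ a, ∑ b, Module.finrank k (P b ⟶ (cokernel φ).val a) < d := by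
    simp only [hadd, Finset.sum_add_distrib] at hd
    omega
  refine hcls.trans ?_
  rw [ih _ hlt (cokernel φ) hM' rfl]
  simp only [hadd, add_smul, Finset.sum_add_distrib]
  congr 1
  rw [grClass_eq_of_iso (asIso (coverCoendBoxHom (P := P) hbox.birex (V i) (V j)))]
  rw [Finset.sum_eq_single i, Finset.sum_eq_single j]
  · simp [hbx]
  · intro b _ hb; simp [hbx, hb]
  · simp
  · intro a _ ha; simp [hbx, ha]
  · simp

end Devissage

/-! ### Transposition between `Q ⟶ *X` and `X ⟶ Q^*` -/

section Transposes

variable {C : Type u₁} [Category.{v} C] [MonoidalCategory C] [RigidCategory C]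

/-- The morphism `X ⟶ Qᘁ` corresponding to a morphism `Q ⟶ ᘁX`. -/
def rightTranspose {Q X : C} (f : Q ⟶ ᘁX) : X ⟶ Qᘁ :=
  tensorRightHomEquiv X Q Qᘁ (𝟙_ C) (X ◁ f ≫ ε_ (ᘁX) X) ≫ (λ_ _).hom

/-- The morphism `Q ⟶ ᘁX` corresponding to a morphism `X ⟶ Qᘁ`. -/
def leftTranspose {Q X : C} (g : X ⟶ Qᘁ) : Q ⟶ ᘁX :=
  tensorLeftHomEquiv Q (ᘁX) X (𝟙_ C) (g ▷ Q ≫ ε_ Q Qᘁ) ≫ (ρ_ _).hom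

/-- A morphism into a dual is determined by its pairing under evaluation. This reduces the
transposition identities below to identities between pairings. -/
theorem whiskerRight_evaluation_injective {Q X : C} {g g' : X ⟶ Qᘁ}
    (h : g ▷ Q ≫ ε_ Q Qᘁ = g' ▷ Q ≫ ε_ Q Qᘁ) : g = g' := by
  have := congrArg (tensorRightHomEquiv X Q Qᘁ (𝟙_ C)) h
  rwa [tensorRightHomEquiv_whiskerRight_comp_evaluation,
    tensorRightHomEquiv_whiskerRight_comp_evaluation, cancel_mono] at this

theorem whiskerLeft_evaluation_injective {Q X : C} {f f' : Q ⟶ ᘁX}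
    (h : X ◁ f ≫ ε_ (ᘁX) X = X ◁ f' ≫ ε_ (ᘁX) X) : f = f' := by
  have := congrArg (tensorLeftHomEquiv Q (ᘁX) X (𝟙_ C)) h
  rwa [tensorLeftHomEquiv_whiskerLeft_comp_evaluation,
    tensorLeftHomEquiv_whiskerLeft_comp_evaluation, cancel_mono] at this

theorem rightTranspose_whiskerRight_evaluation {Q X : C} (f : Q ⟶ ᘁX) :
    rightTranspose f ▷ Q ≫ ε_ Q Qᘁ = X ◁ f ≫ ε_ (ᘁX) X := by
  apply (tensorRightHomEquiv X Q Qᘁ (𝟙_ C)).injective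
  rw [tensorRightHomEquiv_whiskerRight_comp_evaluation, rightTranspose, Category.assoc,
    Iso.hom_inv_id, Category.comp_id]

theorem whiskerLeft_leftTranspose_evaluation {Q X : C} (g : X ⟶ Qᘁ) :
    X ◁ leftTranspose g ≫ ε_ (ᘁX) X = g ▷ Q ≫ ε_ Q Qᘁ := by
  apply (tensorLeftHomEquiv Q (ᘁX) X (𝟙_ C)).injective
  rw [tensorLeftHomEquiv_whiskerLeft_comp_evaluation, leftTranspose, Category.assoc,
    Iso.hom_inv_id, Category.comp_id]

theorem rightTranspose_leftTranspose {Q X : C} (g : X ⟶ Qᘁ) :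
    rightTranspose (leftTranspose g) = g :=
  whiskerRight_evaluation_injective (by
    rw [rightTranspose_whiskerRight_evaluation, whiskerLeft_leftTranspose_evaluation])

theorem rightTranspose_injective {Q X : C} {f f' : Q ⟶ ᘁX}
    (h : rightTranspose f = rightTranspose f') : f = f' :=
  whiskerLeft_evaluation_injective (by
    rw [← rightTranspose_whiskerRight_evaluation, h, rightTranspose_whiskerRight_evaluation])

theorem rightTranspose_comp_left {Q Q' X : C} (r : Q ⟶ Q') (f : Q' ⟶ ᘁX) :
    rightTranspose (r ≫ f) = rightTranspose f ≫ rᘁ :=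
  whiskerRight_evaluation_injective (by
    rw [rightTranspose_whiskerRight_evaluation, comp_whiskerRight, Category.assoc,
      rightAdjointMate_comp_evaluation, ← whisker_exchange_assoc,
      rightTranspose_whiskerRight_evaluation, whiskerLeft_comp, Category.assoc])

theorem rightTranspose_comp_right {Q X Y : C} (f : Q ⟶ ᘁY) (g : X ⟶ Y) :
    rightTranspose (f ≫ ᘁg) = g ≫ rightTranspose f :=
  whiskerRight_evaluation_injective (by
    rw [rightTranspose_whiskerRight_evaluation, comp_whiskerRight, Category.assoc,
      rightTranspose_whiskerRight_evaluation, whiskerLeft_comp, Category.assoc,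
      leftAdjointMate_comp_evaluation, whisker_exchange_assoc])

variable [Preadditive C] [MonoidalPreadditive C]

theorem rightTranspose_add {Q X : C} (f g : Q ⟶ ᘁX) :
    rightTranspose (f + g) = rightTranspose f + rightTranspose g :=
  whiskerRight_evaluation_injective (by
    simp only [MonoidalPreadditive.add_whiskerRight, MonoidalPreadditive.whiskerLeft_add,
      Preadditive.add_comp, rightTranspose_whiskerRight_evaluation])

theorem rightAdjointMate_add {X Y : C} (f g : X ⟶ Y) : (f + g)ᘁ = fᘁ + gᘁ :=
  whiskerRight_evaluation_injective (by
    simp only [MonoidalPreadditive.add_whiskerRight, MonoidalPreadditive.whiskerLeft_add,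
      Preadditive.add_comp, rightAdjointMate_comp_evaluation])

theorem rightAdjointMate_smul {k : Type w} [Field k] [Linear k C] [MonoidalLinear k C]
    {X Y : C} (c : k) (f : X ⟶ Y) : (c • f)ᘁ = c • fᘁ :=
  whiskerRight_evaluation_injective (by
    simp only [MonoidalLinear.smul_whiskerRight, MonoidalLinear.whiskerLeft_smul,
      Linear.smul_comp, rightAdjointMate_comp_evaluation])

end Transposes

/-! ### Reduction of the coend over `C` to the finite coend -/

section Coend

variable {k : Type w} [Field k]
  {C : Type u₁} [Category.{v} C] [Abelian C] [Linear k C] [MonoidalCategory C] [RigidCategory C]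
  {D : Type u₂} [Category.{v} D] [Abelian D] [Linear k D]
  {n : ℕ} {V P : Fin n → C} {π : ∀ i, P i ⟶ V i} {box : C ⥤ C ⥤ D}

variable (P) in
/-- The functor `P a ↦ F ((P a)ᘁ)`. -/
def dualMod (F : C ⥤ C) : CoverMod P :=
  CoverMod.mk (fun a => F.obj ((P a)ᘁ)) (fun r => F.map (rᘁ))
    (fun a => by rw [rightAdjointMate_id, F.map_id])
    (fun r s => by rw [comp_rightAdjointMate, F.map_comp])

theorem isLinear_dualMod [MonoidalPreadditive C] [MonoidalLinear k C] (F : C ⥤ C) [F.Additive]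
    [F.Linear k] : (dualMod P F).IsLinear k where
  act_add r s := (congrArg F.map (rightAdjointMate_add r s)).trans (F.map_add)
  act_smul c r := (congrArg F.map (rightAdjointMate_smul c r)).trans (F.map_smul _ _)

variable [∀ X Y : C, Module.Finite k (X ⟶ Y)]

variable (k P box) in
/-- The coprojections of the coend of `P a ⊠ F ((P a)ᘁ)`. -/
noncomputable def dualMod.ins (F : C ⥤ C) (a : Fin n) :
    (box.obj (P a)).obj (F.obj ((P a)ᘁ)) ⟶ coverCoendObj k box (dualMod P F) :=
  coverCoendObj.ins k box (dualMod P F) a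

variable [MonoidalPreadditive C] [MonoidalLinear k C]

theorem dualMod.condition (hbox : IsBirex k box) (F : C ⥤ C) [F.Additive] [F.Linear k]
    {a b : Fin n} (r : P a ⟶ P b) :
    (box.obj (P a)).map (F.map (rᘁ)) ≫ dualMod.ins k P box F a =
      (box.map r).app (F.obj ((P b)ᘁ)) ≫ dualMod.ins k P box F b :=
  coverCoendObj.condition hbox (isLinear_dualMod F) r

-- Without this, `ᘁ((P a)ᘁ)` would be read as `P a` itself rather than as the value of the chosen
-- dual that appears in the integrand.
attribute [-instance] hasLeftDualRightDual

/-- By descent for `- ⊠ F X` it suffices to give compatible maps for all `f : P a ⟶ *X`. The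
transpose `X ⟶ (P a)^*` of `f` sends `P a ⊠ F X` to `P a ⊠ F((P a)^*)`. -/
theorem IsCoverSystem.exists_coend_π (h : IsCoverSystem π) (hbox : IsBirex k box) (F : C ⥤ C)
    [F.Additive] [F.Linear k] (X : C) :
    ∃ t : (box.obj (ᘁX)).obj (F.obj X) ⟶ coverCoendObj k box (dualMod P F),
      ∀ a (f : P a ⟶ ᘁX), (box.map f).app (F.obj X) ≫ t =
        (box.obj (P a)).map (F.map (rightTranspose f)) ≫
          dualMod.ins k P box F a := by
  obtain ⟨_, _, _⟩ := hbox.left (F.obj X)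
  have := fun Y => (hbox.right Y).additive
  refine h.exists_descent k (box.flip.obj (F.obj X))
    (fun a f => (box.obj (P a)).map (F.map (rightTranspose f)) ≫
      dualMod.ins k P box F a) (fun a f g => ?_) (fun a b r f => ?_)
  · rw [rightTranspose_add, F.map_add, Functor.map_add, Preadditive.add_comp]
  · rw [rightTranspose_comp_left, F.map_comp, Functor.map_comp, Category.assoc,
      dualMod.condition hbox, NatTrans.naturality_assoc]
    rfl

/-- The coend of `X ↦ *X ⊠ F X` is the coend of `P a ⊠ F ((P a)ᘁ)`. -/
theorem IsCoverSystem.exists_isColimit_cowedge (h : IsCoverSystem π) (hbox : IsBirex k box)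
    (F : C ⥤ C) [F.Additive] [F.Linear k] :
    ∃ c : Cowedge (coendIntegrand box F),
      c.pt = coverCoendObj k box (dualMod P F) ∧ Nonempty (IsColimit c) := by
  choose t ht using fun X => h.exists_coend_π hbox F X
  have hflip := fun Y => (hbox.left Y).additive
  have hfin := fun Y => (hbox.left Y).rightExact
  -- The canonical map into the double dual is universal: by `hir`, every `f : P a ⟶ *X` is `i a`
  -- followed by the dual of its transpose.
  let i : ∀ a, P a ⟶ ᘁ((P a)ᘁ) := fun a => leftTranspose (𝟙 _)
  have hi : ∀ a, rightTranspose (i a) = 𝟙 _ := fun a => rightTranspose_leftTranspose _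
  have hir : ∀ {a} {X : C} (f : P a ⟶ ᘁX), i a ≫ (ᘁ(rightTranspose f)) = f := fun f =>
    rightTranspose_injective (by rw [rightTranspose_comp_right, hi, Category.comp_id])
  have hit : ∀ a, (box.map (i a)).app (F.obj ((P a)ᘁ)) ≫ t ((P a)ᘁ) =
      dualMod.ins k P box F a := by
    intro a
    rw [ht, hi, F.map_id, (box.obj (P a)).map_id]
    exact Category.id_comp _
  have hwedge : ∀ ⦃X Y : C⦄ (g : X ⟶ Y),
      (box.map (ᘁg)).app (F.obj X) ≫ t X = (box.obj (ᘁY)).map (F.map g) ≫ t Y := by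
    intro X Y g
    refine h.map_hom_ext k (box.flip.obj (F.obj X)) fun a f => ?_
    change (box.map f).app (F.obj X) ≫ _ = (box.map f).app (F.obj X) ≫ _
    rw [← NatTrans.comp_app_assoc, ← box.map_comp, ht, rightTranspose_comp_right,
      ← NatTrans.naturality_assoc, ht, F.map_comp, Functor.map_comp, Category.assoc]
  -- Dinaturality of `p` along the transpose of `f` expresses `p X`, restricted along `f`, by the
  -- component of `p` at `(P a)^*`. Thus these finitely many components determine `p`.
  have hdesc : ∀ {T : D} (p : ∀ X : C, (box.obj (ᘁX)).obj (F.obj X) ⟶ T)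
      (_ : ∀ ⦃X Y : C⦄ (g : X ⟶ Y),
        (box.map (ᘁg)).app (F.obj X) ≫ p X = (box.obj (ᘁY)).map (F.map g) ≫ p Y)
      {a : Fin n} {X : C} (f : P a ⟶ ᘁX),
      (box.obj (P a)).map (F.map (rightTranspose f)) ≫ (box.map (i a)).app (F.obj ((P a)ᘁ)) ≫
        p ((P a)ᘁ) = (box.map f).app (F.obj X) ≫ p X := by
    intro T p hp a X f
    rw [NatTrans.naturality_assoc, ← hp, ← NatTrans.comp_app_assoc, ← box.map_comp, hir]
  have huniv : ∀ {T : D} (p : ∀ X : C, (box.obj (ᘁX)).obj (F.obj X) ⟶ T)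
      (_ : ∀ ⦃X Y : C⦄ (g : X ⟶ Y),
        (box.map (ᘁg)).app (F.obj X) ≫ p X = (box.obj (ᘁY)).map (F.map g) ≫ p Y),
      ∃ q : coverCoendObj k box (dualMod P F) ⟶ T, ∀ X, t X ≫ q = p X := by
    intro T p hp
    have hcond : ∀ {a b : Fin n} (r : P a ⟶ P b),
        (box.obj (P a)).map (F.map (rᘁ)) ≫ (box.map (i a)).app (F.obj ((P a)ᘁ)) ≫ p ((P a)ᘁ) =
          (box.map r).app (F.obj ((P b)ᘁ)) ≫ (box.map (i b)).app (F.obj ((P b)ᘁ)) ≫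
            p ((P b)ᘁ) := by
      intro a b r
      have := hdesc p hp (r ≫ i b)
      rwa [rightTranspose_comp_left, hi, Category.id_comp, box.map_comp,
        NatTrans.comp_app_assoc] at this
    refine ⟨coverCoendObj.desc (fun a => (box.map (i a)).app (F.obj ((P a)ᘁ)) ≫ p ((P a)ᘁ))
      (fun a b j => hcond _), fun X => ?_⟩
    refine h.map_hom_ext k (box.flip.obj (F.obj X)) fun a f => ?_
    change (box.map f).app (F.obj X) ≫ t X ≫ _ = (box.map f).app (F.obj X) ≫ p X
    rw [← Category.assoc, ht, Category.assoc, ← hdesc p hp]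
    exact _ ≫= coverCoendObj.ins_desc _ _ a
  have huniv' : ∀ s : Cowedge (coendIntegrand box F),
      ∃ q : coverCoendObj k box (dualMod P F) ⟶ s.pt, ∀ X, t X ≫ q = s.π X :=
    fun s => huniv (fun X => s.π X) fun X Y g => Cowedge.condition s g
  have hext : ∀ {T : D} {q q' : coverCoendObj k box (dualMod P F) ⟶ T},
      (∀ X, t X ≫ q = t X ≫ q') → q = q' := by
    intro T q q' hq
    refine coverCoendObj.hom_ext fun a => ?_
    change dualMod.ins k P box F a ≫ _ = dualMod.ins k P box F a ≫ _
    rw [← hit, Category.assoc, Category.assoc, hq]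
  choose q hq using huniv'
  exact ⟨Cowedge.mk _ t hwedge, rfl, ⟨Multicofork.IsColimit.mk _ q hq fun s m hm =>
    hext fun X => (hm X).trans (hq s X).symm⟩⟩

end Coend

end FTC

/-! ### The main theorem -/

theorem mainTheorem11
    {k : Type w} [Field k] [IsAlgClosed k]
    {C : Type u₁} [Category.{v} C] [Abelian C] [Linear k C]
    [MonoidalCategory C] [RigidCategory C] [FTC.IsFiniteTensorCategory k C]
    {D : Type u₂} [Category.{v} D] [Abelian D] [Linear k D]
    (box : C ⥤ C ⥤ D) (hbox : FTC.IsDeligneProduct k box)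
    {ι : Type u} [Fintype ι] (V P : ι → C)
    (hVsimple : ∀ i, Simple (V i))
    (hVcomplete : ∀ S : C, Simple S → ∃! i, Nonempty (S ≅ V i))
    (π : ∀ i, P i ⟶ V i) (hπ : ∀ i, FTC.IsProjectiveCover (π i))
    (F : C ⥤ C) [F.Additive] [F.Linear k] [PreservesFiniteLimits F] :
    HasCoend (FTC.coendIntegrand box F) ∧
    ∀ c : Cowedge (FTC.coendIntegrand box F), IsColimit c →
      FTC.grClass c.pt =
        ∑ i, ∑ j, FTC.multiplicity (F.obj ((P i)ᘁ)) (V j) •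
          FTC.grClass ((box.obj (V i)).obj (V j)) := by
  have hfin : ∀ X Y : C, Module.Finite k (X ⟶ Y) := FTC.IsFiniteAbelian.finite_hom
  let e := Fintype.equivFin ι
  have h : FTC.IsCoverSystem (fun i => π (e.symm i)) :=
    { simple := fun i => hVsimple _
      complete := fun S hS => by
        obtain ⟨i, hi, -⟩ := hVcomplete S hS
        exact ⟨e i, by rwa [e.symm_apply_apply]⟩
      eq_of_iso := fun {i j} φ => e.symm.injective
        ((hVcomplete _ (hVsimple (e.symm i))).unique ⟨Iso.refl _⟩ ⟨φ⟩)
      cover := fun i => hπ _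
      exists_simple_quotient := fun X hX => FTC.IsFiniteAbelian.exists_simple_quotient k X hX }
  obtain ⟨c₀, hpt, ⟨hc₀⟩⟩ := h.exists_isColimit_cowedge hbox.birex F
  refine ⟨⟨⟨c₀, hc₀⟩⟩, fun c hc => ?_⟩
  -- Any coend is isomorphic to the constructed one, so the class formula for the finite coend
  -- applies, with `M a = F((P a)^*)`.
  rw [FTC.grClass_eq_of_iso (hc.coconePointUniqueUpToIso hc₀), hpt,
    hbox.grClass_coverCoendObj h _ _ (FTC.isLinear_dualMod F) rfl]
  refine Fintype.sum_equiv e.symm _ _ fun a => Fintype.sum_equiv e.symm _ _ fun b => ?_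
  rw [h.multiplicity_eq_finrank k (F.obj ((P (e.symm a))ᘁ)) b]
  rfl
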